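/- Let $k$ be an algebraically closed field of characteristic $0$. Let $m\ge 1$ and $d\ge 0$ be integers such that $(1+m)d$ is even, and let $\xi\in k$ be a primitive $2m$-th root of unity. Put $\omega:=md$, $\gamma:=\xi^2$. Let $D(m,d,\xi)$ be the associative unital $k$-algebra generated by $x,x^{-1},g,y,u_0,\dots,u_{m-1}$ subject to the relations, for all $0\le i,j\le m-1$, $$xx^{-1}=x^{-1}x=1,\quad xg=gx,\quad xy=yx,\quad yg=\gamma gy,\quad y^m=1-x^{\omega}=1-g^m,$$ $$xu_i=u_ix^{-1},\quad yu_i=\phi_iu_{i+1}=\xi x^d u_i y,\quad u_ig=\gamma^i x^{-2d}gu_i,$$ $$u_iu_j=\begin{cases}(-1)^{-j}\xi^{-j}\gamma^{\frac{j(j+1)}2}\frac1m\,x^{-\frac{1+m}2d}\,\phi_i\phi_{i+1}\cdots\phi_{m-2-j}\,y^{i+j}g,& i+j\le m-2,\\[2pt](-1)^{-j}\xi^{-j}\gamma^{\frac{j(j+1)}2}\frac1m\,x^{-\frac{1+m}2d}\,y^{i+j}g,& i+j=m-1,\\[2pt](-1)^{-j}\xi^{-j}\gamma^{\frac{j(j+1)}2}\frac1m\,x^{-\frac{1+m}2d}\,\phi_i\cdots\phi_{m-1}\phi_0\cdots\phi_{m-2-j}\,y^{i+j-m}g,&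 i+j\ge m,\end{cases}$$ where $\phi_i:=1-\gamma^{-i-1}x^d$, indices of the $u$'s are read modulo $m$, and the product $\phi_0\cdots\phi_{m-2-j}$ is empty when $j=m-1$. (The element $g$ is invertible, since $g^m=x^{\omega}$.) Then the algebra $D(m,d,\xi)$ is a Hopf algebra over $k$, with coproduct $\Delta$ and counit $\epsilon$ (algebra homomorphisms) and antipode $S$ (an algebra anti-homomorphism) given on generators, for $0\le i\le m-1$ and $1\le s\le m-1$, by $$\Delta(x)=x\otimes x,\quad \Delta(g)=g\otimes g,\quad \Delta(y)=y\otimes g+1\otimes y,\quad \Delta(u_i)=\sum_{j=0}^{m-1}\gamma^{j(i-j)}\,u_j\otimes x^{-jd}g^ju_{i-j},$$ $$\epsilon(x)=\epsilon(g)=\epsilon(u_0)=1,\qquad \epsilon(y)=\epsilon(u_s)=0,$$ $$S(x)=x^{-1},\quad S(g)=g^{-1},\quad S(y)=-yg^{-1},\quad S(u_i)=(-1)^i\xi^{-i}\gamma^{-\frac{i(i+1)}2}x^{id+\frac32(1-m)d}g^{m-i-1}u_i.$$ -/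

import Mathlib

open scoped TensorProduct

namespace DHopf

/-- The generators `x`, `x⁻¹`, `g`, `y`, `u_0, …, u_{m-1}`; the index of `u` is a residue
class modulo `m`, so that `u_s` makes sense for every integer `s`, as in `u_s := u_{s mod m}`. -/
inductive Gen (m : ℕ) : Type
  | x : Gen m
  | xinv : Gen m
  | g : Gen m
  | y : Gen m
  | u : ZMod m → Gen m

section Free

variable {k : Type*} [Field k] (m d : ℕ) (ξ : k)

/-- The free associative `k`-algebra on the generators. -/
abbrev Free (k : Type*) [Field k] (m : ℕ) : Type _ := FreeAlgebra k (Gen m)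

/-- The free generator `x`. -/
def fx (k : Type*) [Field k] (m : ℕ) : Free k m := FreeAlgebra.ι k Gen.x

/-- The free generator that becomes `x⁻¹`. -/
def fxinv (k : Type*) [Field k] (m : ℕ) : Free k m := FreeAlgebra.ι k Gen.xinv

/-- The free generator `g`. -/
def fg (k : Type*) [Field k] (m : ℕ) : Free k m := FreeAlgebra.ι k Gen.g

/-- The free generator `y`. -/
def fy (k : Type*) [Field k] (m : ℕ) : Free k m := FreeAlgebra.ι k Gen.y

/-- The free generator `u_s`, where `s` is read modulo `m`. -/
def fu (k : Type*) [Field k] (m : ℕ) (s : ℤ) : Free k m := FreeAlgebra.ι k (Gen.u (s : ZMod m))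

/-- `φ_i = 1 - γ^{-i-1} x^d`, where `γ = ξ²`. -/
noncomputable def fphi (i : ℕ) : Free k m :=
  1 - (ξ ^ 2) ^ (-(i : ℤ) - 1) • fx k m ^ d

/-- The ordered product `φ_a φ_{a+1} ⋯ φ_{b-1}` (equal to `1` if `b ≤ a`). -/
noncomputable def fphiProd (a b : ℕ) : Free k m :=
  ((List.range' a (b - a)).map (fphi m d ξ)).prod

/-- The scalar `(-1)^{-j} ξ^{-j} γ^{j(j+1)/2} / m`, where `γ = ξ²`. -/
noncomputable def coef (j : ℕ) : k :=
  (-1 : k) ^ (-(j : ℤ)) * ξ ^ (-(j : ℤ)) * (ξ ^ 2) ^ (j * (j + 1) / 2) * (1 / (m : k))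

/-- The defining relations of `D(m,d,ξ)`, with `ω = m d` and `γ = ξ²`. The exponent
`(1+m)d/2` is an exact quotient as soon as `(1+m)d` is even. -/
inductive Rel : Free k m → Free k m → Prop
  | x_mul_xinv : Rel (fx k m * fxinv k m) 1
  | xinv_mul_x : Rel (fxinv k m * fx k m) 1
  | x_g : Rel (fx k m * fg k m) (fg k m * fx k m)
  | x_y : Rel (fx k m * fy k m) (fy k m * fx k m)
  | y_g : Rel (fy k m * fg k m) (ξ ^ 2 • (fg k m * fy k m))
  | y_pow : Rel (fy k m ^ m) (1 - fx k m ^ (m * d))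
  | g_pow : Rel (1 - fx k m ^ (m * d)) (1 - fg k m ^ m)
  | x_u (i : ℕ) (hi : i < m) : Rel (fx k m * fu k m i) (fu k m i * fxinv k m)
  | y_u (i : ℕ) (hi : i < m) : Rel (fy k m * fu k m i) (fphi m d ξ i * fu k m (i + 1))
  | y_u' (i : ℕ) (hi : i < m) :
      Rel (fphi m d ξ i * fu k m (i + 1)) (ξ • (fx k m ^ d * fu k m i * fy k m))
  | u_g (i : ℕ) (hi : i < m) :
      Rel (fu k m i * fg k m) ((ξ ^ 2) ^ i • (fxinv k m ^ (2 * d) * fg k m * fu k m i))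
  | u_u_lt (i j : ℕ) (hi : i < m) (hj : j < m) (hij : i + j + 2 ≤ m) :
      Rel (fu k m i * fu k m j)
        (coef m ξ j • (fxinv k m ^ ((1 + m) * d / 2) * fphiProd m d ξ i (m - 1 - j)
          * fy k m ^ (i + j) * fg k m))
  | u_u_eq (i j : ℕ) (hi : i < m) (hj : j < m) (hij : i + j + 1 = m) :
      Rel (fu k m i * fu k m j)
        (coef m ξ j • (fxinv k m ^ ((1 + m) * d / 2) * fy k m ^ (i + j) * fg k m))
  | u_u_gt (i j : ℕ) (hi : i < m) (hj : j < m) (hij : m ≤ i + j) :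
      Rel (fu k m i * fu k m j)
        (coef m ξ j • (fxinv k m ^ ((1 + m) * d / 2)
          * (fphiProd m d ξ i m * fphiProd m d ξ 0 (m - 1 - j))
          * fy k m ^ (i + j - m) * fg k m))

end Free

variable {k : Type*} [Field k]

/-- The algebra `D(m,d,ξ)`: the free algebra on the generators modulo the two-sided ideal
generated by the relations. -/
def D (m d : ℕ) (ξ : k) : Type _ := RingQuot (Rel m d ξ)

noncomputable instance instRing (m d : ℕ) (ξ : k) : Ring (D m d ξ) :=
  inferInstanceAs (Ring (RingQuot (Rel m d ξ)))

/-- The `k`-algebra structure of the quotient. It is not declared as a global instance, so that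
a Hopf algebra structure on `D(m,d,ξ)`, which carries an algebra structure of its own, can be
compared with it. -/
@[reducible] noncomputable def algebra (m d : ℕ) (ξ : k) : Algebra k (D m d ξ) :=
  inferInstanceAs (Algebra k (RingQuot (Rel m d ξ)))

section Elements

variable (m d : ℕ) (ξ : k)

/-- The quotient map from the free algebra. -/
noncomputable def mk : Free k m →+* D m d ξ := RingQuot.mkRingHom (Rel m d ξ)

theorem mk_rel {a b : Free k m} (h : Rel m d ξ a b) : mk m d ξ a = mk m d ξ b :=
  RingQuot.mkRingHom_rel h

/-- The quotient map is `k`-linear for the algebra structure of `D(m,d,ξ)`. -/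
theorem mk_algebraMap (c : k) :
    mk m d ξ (algebraMap k (Free k m) c)
      = (algebra m d ξ).algebraMap c := by
  have h := (RingQuot.mkAlgHom k (Rel m d ξ)).commutes c
  rw [← AlgHom.coe_toRingHom, RingQuot.mkAlgHom_coe] at h
  exact h

/-- The element `x` of `D(m,d,ξ)`, as a unit with inverse `x⁻¹`. -/
noncomputable def x : (D m d ξ)ˣ where
  val := mk m d ξ (fx k m)
  inv := mk m d ξ (fxinv k m)
  val_inv := by rw [← map_mul, mk_rel m d ξ Rel.x_mul_xinv, map_one]
  inv_val := by rw [← map_mul, mk_rel m d ξ Rel.xinv_mul_x, map_one]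

theorem g_pow_eq : mk m d ξ (fg k m) ^ m = ((x m d ξ ^ (m * d) : (D m d ξ)ˣ) : D m d ξ) := by
  have h := mk_rel m d ξ Rel.g_pow
  simp only [map_sub, map_one, map_pow] at h
  exact (sub_right_injective h).symm

/-- The element `g` of `D(m,d,ξ)`, as a unit; it is invertible because `g^m = x^{md}`. -/
noncomputable def g [NeZero m] : (D m d ξ)ˣ :=
  Units.ofPow (x m d ξ ^ (m * d)) (mk m d ξ (fg k m)) (NeZero.ne m) (g_pow_eq m d ξ)

@[simp] theorem val_x : (x m d ξ : D m d ξ) = mk m d ξ (fx k m) := rfl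

@[simp] theorem val_g [NeZero m] : (g m d ξ : D m d ξ) = mk m d ξ (fg k m) := rfl

/-- The element `y` of `D(m,d,ξ)`. -/
noncomputable def y : D m d ξ := mk m d ξ (fy k m)

/-- The element `u_s` of `D(m,d,ξ)`, for any integer `s` read modulo `m`. -/
noncomputable def u (s : ℤ) : D m d ξ := mk m d ξ (fu k m s)

end Elements

end DHopf

/-! An algebra map out of D(m,d,ξ) amounts to a choice of elements satisfying the relations. Each
structure map is therefore given by such elements: in D ⊗ D for the coproduct, in k for the counit,
in the opposite algebra for the antipode (`Sys.tensor`, `sysCounit`, `Sys.opposite`, all passed to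
`Sys.lift`). The Hopf axioms then only need checking on generators.

Two changes of form make the relations manageable. First, g is replaced by z = x^(-d) g, which
satisfies z^m = 1; exponents of z and indices of u then live in `ZMod m`, and all phases are values
of the character `chi` and the quadratic function `quad`. Second, the products of the φ's are
expanded in Gaussian binomials at a root of unity (`prod_range'_eq_sum`). This fuses the three cases
for u_i u_j: if p < m represents i + j, the product is a combination over r of x^(dr+d-e) z y^p.

The relation for u_i u_j is the hard one. In D ⊗ D, fix the degree P of the left factor: the
quadratic phases cancel, orthogonality of characters links the two expansion indices by s = r + P
(`sum_phase`), and a trinomial identity (`qbin_mul_qbin`) together with the q-binomial expansion of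
the power of Δ(y) reassembles the answer (`Sys.uu_mul_uu`). In the opposite algebra the sum over r
is reversed, which is matched by `qbin_reflect` and 2e = (1+m)d (`Sys.ua_mul_ua`). The antipode
axioms at u_i follow from orthogonality once more. -/

namespace DHopf

/-! ### Gaussian binomial coefficients -/

section Gauss

variable {k : Type*} [Field k]

/-- The product `(1 - q)(1 - q²)⋯(1 - qⁿ)`. -/
def qfac (q : k) (n : ℕ) : k := ∏ t ∈ Finset.range n, (1 - q ^ (t + 1))

theorem qfac_zero (q : k) : qfac q 0 = 1 := by simp [qfac]

theorem qfac_succ (q : k) (n : ℕ) : qfac q (n + 1) = qfac q n * (1 - q ^ (n + 1)) := by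
  simp [qfac, Finset.prod_range_succ]

/-- The Gaussian binomial coefficient `p + r` choose `r`. -/
def qbin (q : k) : ℕ → ℕ → k
  | 0, _ => 1
  | _ + 1, 0 => 1
  | p + 1, r + 1 => qbin q p (r + 1) + q ^ (p + 1) * qbin q (p + 1) r

theorem qbin_zero_left (q : k) (r : ℕ) : qbin q 0 r = 1 := by simp [qbin]

theorem qbin_zero_right (q : k) (p : ℕ) : qbin q p 0 = 1 := by cases p <;> simp [qbin]

theorem qbin_succ_succ (q : k) (p r : ℕ) :
    qbin q (p + 1) (r + 1) = qbin q p (r + 1) + q ^ (p + 1) * qbin q (p + 1) r := by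
  rw [qbin]

/-- Kept free of division because `qfac` vanishes at roots of unity. Pascal's rule reduces it to 1 -
q^(p+r+2) = (1 - q^(p+1)) + q^(p+1) (1 - q^(r+1)). -/
theorem qbin_mul_qfac (q : k) (p r : ℕ) :
    qbin q p r * (qfac q p * qfac q r) = qfac q (p + r) := by
  induction p generalizing r with
  | zero => simp [qbin_zero_left, qfac_zero]
  | succ p ihp =>
    induction r with
    | zero => simp [qbin_zero_right, qfac_zero]
    | succ r ihr =>
      have h1 := ihp (r + 1)
      have h2 : p + 1 + (r + 1) = (p + 1 + r) + 1 := by ring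
      have h3 : p + (r + 1) = p + 1 + r := by ring
      rw [h3] at h1
      rw [qbin_succ_succ, h2, qfac_succ q (p + 1 + r)]
      calc _ = (qbin q p (r + 1) * (qfac q p * qfac q (r + 1))) * (1 - q ^ (p + 1))
            + q ^ (p + 1) * (1 - q ^ (r + 1))
              * (qbin q (p + 1) r * (qfac q (p + 1) * qfac q r)) := by
              rw [qfac_succ q p, qfac_succ q r]; ring
        _ = _ := by rw [h1, ihr]; ring

/-- The `q`-binomial theorem. -/
theorem add_pow_of_qcomm {A : Type*} [Ring A] [Algebra k A] (q : k) (a b : A)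
    (h : b * a = q • (a * b)) (n : ℕ) :
    (a + b) ^ n = ∑ p ∈ Finset.HasAntidiagonal.antidiagonal n, qbin q p.1 p.2 • (a ^ p.1 * b ^ p.2) := by
  have hb : ∀ p : ℕ, b * a ^ p = q ^ p • (a ^ p * b) := by
    intro p
    induction p with
    | zero => simp
    | succ p ih =>
      rw [pow_succ, ← mul_assoc, ih, smul_mul_assoc, mul_assoc, h, mul_smul_comm, smul_smul,
        ← mul_assoc, pow_succ]
  induction n with
  | zero => simp [qbin_zero_left]
  | succ n ih =>
    rw [pow_succ', ih, add_mul, Finset.mul_sum, Finset.mul_sum]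
    have e1 : ∀ p : ℕ × ℕ, a * qbin q p.1 p.2 • (a ^ p.1 * b ^ p.2)
        = qbin q p.1 p.2 • (a ^ (p.1 + 1) * b ^ p.2) := by
      intro p; rw [mul_smul_comm, ← mul_assoc, ← pow_succ']
    have e2 : ∀ p : ℕ × ℕ, b * qbin q p.1 p.2 • (a ^ p.1 * b ^ p.2)
        = (qbin q p.1 p.2 * q ^ p.1) • (a ^ p.1 * b ^ (p.2 + 1)) := by
      intro p
      rw [mul_smul_comm, ← mul_assoc, hb, smul_mul_assoc, mul_assoc, ← pow_succ', smul_smul]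
    simp only [e1, e2]
    -- Pascal's rule covers only interior terms, so both end terms of the sum are split off; this
    -- needs total degree at least two.
    rcases n with _ | n
    · simp [Finset.Nat.antidiagonal_succ, qbin_zero_left, qbin_zero_right, add_comm]
    · rw [Finset.Nat.sum_antidiagonal_succ' (n := n), Finset.Nat.sum_antidiagonal_succ (n := n),
        Finset.Nat.sum_antidiagonal_succ (n := n + 1), Finset.Nat.sum_antidiagonal_succ' (n := n)]
      simp only [qbin_zero_left, qbin_zero_right, qbin_succ_succ, add_smul, Finset.sum_add_distrib,
        pow_zero, mul_one, one_mul, one_smul, mul_comm (q ^ _)]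
      abel

end Gauss

/-! ### Characters and quadratic phases on `ZMod m` -/

section Phases

variable {k : Type*} [Field k]

/-- The character `a ↦ γ^a` of `ZMod m`, where `γ = ξ²`. -/
def chi (m : ℕ) (ξ : k) (a : ZMod m) : k := (ξ ^ 2) ^ a.val

/-- The quadratic phase `a ↦ (-1)^a ξ^(a²)` on `ZMod m`. -/
def quad (m : ℕ) (ξ : k) (a : ZMod m) : k := (-1) ^ a.val * ξ ^ (a.val ^ 2)

/-- The sign `(-1)^p γ^(p(p+1)/2)`. -/
def tri (ξ : k) (p : ℕ) : k := (-1) ^ p * ξ ^ (p * (p + 1))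

theorem chi_zero {m : ℕ} {ξ : k} : chi m ξ 0 = 1 := by simp [chi]

theorem quad_zero {m : ℕ} {ξ : k} : quad m ξ 0 = 1 := by simp [quad]

theorem tri_zero (ξ : k) : tri ξ 0 = 1 := by simp [tri]

theorem tri_succ (ξ : k) (p : ℕ) : tri ξ (p + 1) = -(ξ ^ 2) ^ (p + 1) * tri ξ p := by
  simp only [tri, ← pow_mul]; ring

theorem tri_add (ξ : k) (p r : ℕ) : tri ξ (p + r) = tri ξ p * tri ξ r * (ξ ^ 2) ^ (p * r) := by
  simp only [tri, ← pow_mul]; ring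

variable {m : ℕ} [NeZero m] {ξ : k}

theorem pow_eq_neg_one (hξ : IsPrimitiveRoot ξ (2 * m)) : ξ ^ m = -1 := by
  have h : (ξ ^ m) ^ 2 = 1 := by rw [← pow_mul, mul_comm, hξ.pow_eq_one]
  rcases mul_self_eq_one_iff.mp ((sq _).symm.trans h) with h | h
  · have := hξ.dvd_of_pow_eq_one m h
    have h2 := Nat.le_of_dvd (NeZero.pos m) this
    have h3 := NeZero.pos m
    omega
  · exact h

theorem isPrimitiveRoot_sq (hξ : IsPrimitiveRoot ξ (2 * m)) : IsPrimitiveRoot (ξ ^ 2) m :=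
  hξ.pow (by have := NeZero.pos m; omega) rfl

theorem sq_pow_eq_one (hξ : IsPrimitiveRoot ξ (2 * m)) : (ξ ^ 2) ^ m = 1 :=
  (isPrimitiveRoot_sq hξ).pow_eq_one

theorem root_ne_zero (hξ : IsPrimitiveRoot ξ (2 * m)) : ξ ≠ 0 :=
  hξ.ne_zero (by have := NeZero.ne m; omega)

theorem chi_natCast (hξ : IsPrimitiveRoot ξ (2 * m)) (n : ℕ) :
    chi m ξ (n : ZMod m) = (ξ ^ 2) ^ n := by
  rw [chi, ZMod.val_natCast, ← pow_eq_pow_mod n (sq_pow_eq_one hξ)]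

theorem chi_add (hξ : IsPrimitiveRoot ξ (2 * m)) (a b : ZMod m) :
    chi m ξ (a + b) = chi m ξ a * chi m ξ b := by
  rw [chi, ZMod.val_add, ← pow_eq_pow_mod _ (sq_pow_eq_one hξ), pow_add]; rfl

theorem chi_ne_zero (hξ : IsPrimitiveRoot ξ (2 * m)) (a : ZMod m) : chi m ξ a ≠ 0 :=
  pow_ne_zero _ (pow_ne_zero _ (root_ne_zero hξ))

theorem chi_neg (hξ : IsPrimitiveRoot ξ (2 * m)) (a : ZMod m) :
    chi m ξ (-a) = (chi m ξ a)⁻¹ := by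
  exact eq_inv_of_mul_eq_one_left (by rw [← chi_add hξ, neg_add_cancel, chi_zero])

theorem chi_intCast (hξ : IsPrimitiveRoot ξ (2 * m)) (n : ℤ) :
    chi m ξ (n : ZMod m) = (ξ ^ 2) ^ n := by
  obtain ⟨n, rfl | rfl⟩ := n.eq_nat_or_neg
  · rw [Int.cast_natCast, chi_natCast hξ, zpow_natCast]
  · rw [Int.cast_neg, Int.cast_natCast, chi_neg hξ, chi_natCast hξ, zpow_neg, zpow_natCast]

/-- Orthogonality of characters: every sum over indices of the u's is eventually collapsed by this.
-/
theorem sum_chi_mul (hξ : IsPrimitiveRoot ξ (2 * m)) (b : ZMod m) :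
    ∑ a : ZMod m, chi m ξ (a * b) = if b = 0 then (m : k) else 0 := by
  have h := AddChar.sum_mulShift b
    (AddChar.zmodChar_primitive_of_primitive_root m (isPrimitiveRoot_sq hξ))
  simpa [AddChar.zmodChar_apply, chi, ZMod.card] using h

/-- Replacing n by n + m multiplies the phase by (-1)^m ξ^(2mn) ξ^(m²) = (-1)^m (-1)^m = 1. For odd
m it is the sign in `quad` that makes it periodic. -/
theorem quad_natCast (hξ : IsPrimitiveRoot ξ (2 * m)) (n : ℕ) :
    quad m ξ (n : ZMod m) = (-1) ^ n * ξ ^ (n ^ 2) := by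
  have hp : Function.Periodic (fun n : ℕ => (-1 : k) ^ n * ξ ^ (n ^ 2)) m := by
    intro n
    have h1 : (n + m) ^ 2 = n ^ 2 + 2 * m * n + m * m := by ring
    have h2 : ((-1 : k) ^ m) * (-1) ^ m = 1 := by
      rw [← mul_pow]; simp
    simp only [h1, pow_add, pow_mul _ (2 * m), hξ.pow_eq_one, pow_mul _ m m, pow_eq_neg_one hξ,
      one_pow, mul_one]
    linear_combination ((-1 : k) ^ n * ξ ^ n ^ 2) * h2
  rw [quad, ZMod.val_natCast]
  exact hp.map_mod_nat n

theorem quad_ne_zero (hξ : IsPrimitiveRoot ξ (2 * m)) (a : ZMod m) : quad m ξ a ≠ 0 :=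
  mul_ne_zero (pow_ne_zero _ (by simp)) (pow_ne_zero _ (root_ne_zero hξ))

/-- The cross term 2ab in (a + b)² contributes a power of γ = ξ²; thus `chi` is the polarization of
`quad`. -/
theorem quad_add (hξ : IsPrimitiveRoot ξ (2 * m)) (a b : ZMod m) :
    quad m ξ (a + b) = quad m ξ a * quad m ξ b * chi m ξ (a * b) := by
  obtain ⟨a, rfl⟩ := ZMod.natCast_zmod_surjective a
  obtain ⟨b, rfl⟩ := ZMod.natCast_zmod_surjective b
  rw [← Nat.cast_add, ← Nat.cast_mul, quad_natCast hξ, quad_natCast hξ, quad_natCast hξ,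
    chi_natCast hξ, ← pow_mul]
  ring

theorem quad_sq (hξ : IsPrimitiveRoot ξ (2 * m)) (a : ZMod m) :
    quad m ξ a * quad m ξ a = chi m ξ (a * a) := by
  obtain ⟨a, rfl⟩ := ZMod.natCast_zmod_surjective a
  rw [← Nat.cast_mul, quad_natCast hξ, chi_natCast hξ, ← pow_mul]
  have h2 : ((-1 : k) ^ a) * (-1) ^ a = 1 := by rw [← mul_pow]; simp
  linear_combination (ξ ^ (2 * (a * a))) * h2

theorem tri_ne_zero (hξ : IsPrimitiveRoot ξ (2 * m)) (p : ℕ) : tri ξ p ≠ 0 :=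
  mul_ne_zero (pow_ne_zero _ (by simp)) (pow_ne_zero _ (root_ne_zero hξ))

theorem tri_self (hξ : IsPrimitiveRoot ξ (2 * m)) : tri ξ m = -1 := by
  have h2 : ((-1 : k) ^ m) * (-1) ^ m = 1 := by rw [← mul_pow]; simp
  rw [tri, pow_mul, pow_eq_neg_one hξ, pow_succ]
  linear_combination -h2

/-! ### Gaussian binomial coefficients at a root of unity -/

theorem qfac_ne_zero (hξ : IsPrimitiveRoot ξ (2 * m)) {n : ℕ} (hn : n < m) :
    qfac (ξ ^ 2) n ≠ 0 := by
  refine Finset.prod_ne_zero_iff.mpr fun t ht h => ?_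
  have h1 := (isPrimitiveRoot_sq hξ).dvd_of_pow_eq_one (t + 1) (sub_eq_zero.mp h).symm
  have h2 := Nat.le_of_dvd (by omega) h1
  have := Finset.mem_range.mp ht
  omega

theorem qfac_self (hξ : IsPrimitiveRoot ξ (2 * m)) : qfac (ξ ^ 2) m = 0 := by
  obtain ⟨n, hn⟩ := Nat.exists_eq_succ_of_ne_zero (NeZero.ne m)
  have h := sq_pow_eq_one hξ
  simp only [hn, Nat.succ_eq_add_one] at h ⊢
  rw [qfac_succ, h, sub_self, mul_zero]

/-- The numerator contains 1 - γ^m = 0, while the denominators involve only smaller exponents. This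
kills the mixed terms of Δ(y)^m. -/
theorem qbin_eq_zero (hξ : IsPrimitiveRoot ξ (2 * m)) {p r : ℕ} (h : p + r + 2 = m) :
    qbin (ξ ^ 2) (p + 1) (r + 1) = 0 := by
  have h1 := qbin_mul_qfac (ξ ^ 2) (p + 1) (r + 1)
  rw [show p + 1 + (r + 1) = m by omega, qfac_self hξ] at h1
  exact (mul_eq_zero.mp h1).resolve_right
    (mul_ne_zero (qfac_ne_zero hξ (by omega)) (qfac_ne_zero hξ (by omega)))

theorem qbin_eq_div (hξ : IsPrimitiveRoot ξ (2 * m)) {p r : ℕ} (hp : p < m) (hr : r < m) :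
    qbin (ξ ^ 2) p r = qfac (ξ ^ 2) (p + r) / (qfac (ξ ^ 2) p * qfac (ξ ^ 2) r) := by
  rw [eq_div_iff (mul_ne_zero (qfac_ne_zero hξ hp) (qfac_ne_zero hξ hr)), qbin_mul_qfac]

/-- Both sides are the Gaussian trinomial coefficient of (p, q, r); the bound on the sum keeps all
denominators nonzero. -/
theorem qbin_mul_qbin (hξ : IsPrimitiveRoot ξ (2 * m)) {p q r : ℕ} (h : p + q + r < m) :
    qbin (ξ ^ 2) p r * qbin (ξ ^ 2) q (p + r)
      = qbin (ξ ^ 2) p q * qbin (ξ ^ 2) (p + q) r := by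
  have h1 := qfac_ne_zero hξ (show p < m by omega)
  have h2 := qfac_ne_zero hξ (show q < m by omega)
  have h3 := qfac_ne_zero hξ (show r < m by omega)
  have h4 := qfac_ne_zero hξ (show p + q < m by omega)
  have h5 := qfac_ne_zero hξ (show p + r < m by omega)
  rw [qbin_eq_div hξ, qbin_eq_div hξ, qbin_eq_div hξ, qbin_eq_div hξ,
    show q + (p + r) = p + q + r by ring] <;> try omega
  field_simp

/-- For complementary exponents a + b = m one has 1 - γ^a = -γ^a (1 - γ^b). Transferring factors one
at a time from one product to the other accumulates `tri`. -/
theorem qfac_mul_qfac (hξ : IsPrimitiveRoot ξ (2 * m)) {n n' : ℕ} (h : n + n' + 1 = m) :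
    qfac (ξ ^ 2) n * qfac (ξ ^ 2) n' = tri ξ n * qfac (ξ ^ 2) (m - 1) := by
  induction n generalizing n' with
  | zero => rw [qfac_zero, tri_zero, show n' = m - 1 by omega]
  | succ n ih =>
    have h1 := ih (n' := n' + 1) (by omega)
    have h2 : (ξ ^ 2) ^ (n + 1) * (ξ ^ 2) ^ (n' + 1) = 1 := by
      rw [← pow_add, show n + 1 + (n' + 1) = m by omega, sq_pow_eq_one hξ]
    rw [tri_succ, mul_assoc, ← h1, qfac_succ, qfac_succ]
    linear_combination (- qfac (ξ ^ 2) n * qfac (ξ ^ 2) n') * h2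

/-- The reflection formula for Gaussian binomial coefficients at an `m`-th root of unity. -/
theorem qbin_reflect (hξ : IsPrimitiveRoot ξ (2 * m)) {p r s : ℕ} (h : p + r + s + 1 = m) :
    qbin (ξ ^ 2) p s * (tri ξ p * (ξ ^ 2) ^ (p * r)) = qbin (ξ ^ 2) p r := by
  have h1 := qfac_ne_zero hξ (show p < m by omega)
  have h2 := qfac_ne_zero hξ (show r < m by omega)
  have h3 := qfac_ne_zero hξ (show s < m by omega)
  -- Both (r, p + s) and (p + r, s) are complementary pairs, so the two products share the factor
  -- `qfac (ξ ^ 2) (m - 1)` and differ only by `tri`.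
  have h4 := qfac_mul_qfac hξ (show r + (p + s) + 1 = m by omega)
  have h5 := qfac_mul_qfac hξ (show (p + r) + s + 1 = m by omega)
  have h6 := tri_ne_zero hξ r
  rw [tri_add] at h5
  rw [qbin_eq_div hξ, qbin_eq_div hξ] <;> try omega
  rw [div_mul_eq_mul_div, div_eq_div_iff (mul_ne_zero h1 h3) (mul_ne_zero h1 h2)]
  refine mul_left_cancel₀ h6 ?_
  linear_combination qfac (ξ ^ 2) p * (tri ξ r * tri ξ p * (ξ ^ 2) ^ (p * r) * h4 - tri ξ r * h5)

/-- A consecutive product of the factors `1 - γ^(-s-1) T` in terms of Gaussian binomials. -/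
theorem prod_range'_eq_sum (hξ : IsPrimitiveRoot ξ (2 * m)) {A : Type*} [Ring A] [Algebra k A]
    (T : A) (i : ℕ) {N p : ℕ} (h : N + p + 1 = m) :
    ((List.range' i N).map fun s : ℕ => 1 - (ξ ^ 2) ^ (-(s : ℤ) - 1) • T).prod
      = ∑ r ∈ Finset.range (m - p),
          (qbin (ξ ^ 2) p r * chi m ξ (-((i : ZMod m) * r))) • T ^ r := by
  induction N generalizing p with
  | zero =>
    rw [show m - p = 1 by omega]
    simp [qbin_zero_right, chi_zero]
  | succ N ih =>
    -- The exponent in the last factor: N + p + 2 = m gives -(i + N) - 1 ≡ (p + 1) - i modulo m.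
    have hc : (ξ ^ 2) ^ (-((i + N : ℕ) : ℤ) - 1) = (ξ ^ 2) ^ (p + 1) * chi m ξ (-(i : ZMod m)) := by
      rw [← chi_intCast hξ, ← chi_natCast hξ, ← chi_add hξ]
      congr 1
      have h0 : ((N + 1 + p + 1 : ℕ) : ZMod m) = 0 := by rw [h, ZMod.natCast_self]
      push_cast at h0 ⊢
      linear_combination -h0
    rw [List.range'_concat, List.map_append, List.prod_append, ih (p := p + 1) (by omega)]
    simp only [List.map_cons, List.map_nil, List.prod_cons, List.prod_nil, mul_one, one_mul]
    have hp : ∀ r : ℕ, qbin (ξ ^ 2) p (r + 1) * chi m ξ (-((i : ZMod m) * (r + 1 : ℕ)))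
        = qbin (ξ ^ 2) (p + 1) (r + 1) * chi m ξ (-((i : ZMod m) * (r + 1 : ℕ)))
          - (qbin (ξ ^ 2) (p + 1) r * chi m ξ (-((i : ZMod m) * r)))
            * ((ξ ^ 2) ^ (p + 1) * chi m ξ (-(i : ZMod m))) := by
      intro r
      rw [qbin_succ_succ, show -((i : ZMod m) * (r + 1 : ℕ)) = -((i : ZMod m) * r) + -i by
        push_cast; ring, chi_add hξ]
      ring
    -- This vanishing extends the sum for p + 1 by the index r = N + 1, giving it the length that
    -- Pascal's rule requires.
    have h0 := qbin_eq_zero hξ (show p + N + 2 = m by omega)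
    rw [mul_sub, mul_one, Finset.sum_mul, show m - p = N + 1 + 1 by omega,
      show m - (p + 1) = N + 1 by omega, hc, Finset.sum_range_succ' _ (N + 1)]
    simp only [hp, sub_smul, Finset.sum_sub_distrib]
    have h2 := Finset.sum_range_succ (fun r : ℕ =>
      (qbin (ξ ^ 2) (p + 1) r * chi m ξ (-((i : ZMod m) * r))) • T ^ r) (N + 1)
    rw [Finset.sum_range_succ', h0, zero_mul, zero_smul, add_zero] at h2
    rw [← h2]
    simp only [smul_mul_smul_comm, ← pow_succ, qbin_zero_right]
    abel

end Phases
end DHopf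

namespace DHopf

/-! ### Systems of elements satisfying the defining relations -/

section Systems

variable {k : Type*} [Field k]

/-- Elements `x`, `z = x^(-d) g`, `y`, `u_i` of a `k`-algebra satisfying the defining relations
of `D(m,d,ξ)`, with `e = (1+m)d/2` and the products of the `φ_i` expanded. -/
structure Sys (m d e : ℕ) (ξ : k) (A : Type*) [Ring A] [Algebra k A] where
  x : Aˣ
  z : A
  y : A
  u : ZMod m → A
  x_z : (x : A) * z = z * x
  x_y : (x : A) * y = y * x
  y_z : y * z = ξ ^ 2 • (z * y)
  z_pow : z ^ m = 1
  y_pow : y ^ m = 1 - (x : A) ^ (m * d)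
  x_u (i : ZMod m) : (x : A) * u i = u i * (x⁻¹ : Aˣ)
  y_u (i : ZMod m) : y * u i = u (i + 1) - chi m ξ (-(i + 1)) • ((x : A) ^ d * u (i + 1))
  u_y (i : ZMod m) : y * u i = ξ • ((x : A) ^ d * u i * y)
  u_z (i : ZMod m) : u i * z = chi m ξ i • (z * u i)
  u_u (i j : ZMod m) : u i * u j = ∑ r ∈ Finset.range (m - (i + j).val),
    ((m : k)⁻¹ * quad m ξ j * qbin (ξ ^ 2) (i + j).val r * chi m ξ (i + j - i * r)) •
      (((x ^ ((d : ℤ) * r + d - e) : Aˣ) : A) * (z * y ^ (i + j).val))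

namespace Sys

variable {m d e : ℕ} {ξ : k} {A : Type*} [Ring A] [Algebra k A] (S : Sys m d e ξ A)

/-- The power `x^n`. -/
def X (n : ℤ) : A := ((S.x ^ n : Aˣ) : A)

/-- The power `z^a`, for a residue class `a` modulo `m`. -/
def Z (a : ZMod m) : A := S.z ^ a.val

theorem X_zero : S.X 0 = 1 := by simp [X]

theorem X_one : S.X 1 = S.x := by simp [X]

theorem X_neg_one : S.X (-1) = (S.x⁻¹ : Aˣ) := by simp [X]

theorem X_natCast (n : ℕ) : S.X n = (S.x : A) ^ n := by simp [X]

theorem X_mul_X (a b : ℤ) : S.X a * S.X b = S.X (a + b) := by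
  rw [X, X, X, zpow_add, Units.val_mul]

theorem X_mul_X_assoc (a b : ℤ) (t : A) : S.X a * (S.X b * t) = S.X (a + b) * t := by
  rw [← mul_assoc, X_mul_X]

theorem commute_X {t : A} (h : (S.x : A) * t = t * S.x) (n : ℤ) : t * S.X n = S.X n * t :=
  (Commute.units_zpow_right (show Commute t (S.x : A) from h.symm) n).eq

theorem z_mul_X (n : ℤ) : S.z * S.X n = S.X n * S.z := S.commute_X S.x_z n

theorem Z_mul_X (a : ZMod m) (n : ℤ) : S.Z a * S.X n = S.X n * S.Z a :=
  (show Commute S.z (S.X n) from S.z_mul_X n).pow_left _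

theorem Z_mul_X_assoc (a : ZMod m) (n : ℤ) (t : A) :
    S.Z a * (S.X n * t) = S.X n * (S.Z a * t) := by
  rw [← mul_assoc, Z_mul_X, mul_assoc]

theorem y_pow_mul_X (p : ℕ) (n : ℤ) : S.y ^ p * S.X n = S.X n * S.y ^ p :=
  (show Commute S.y (S.X n) from S.commute_X S.x_y n).pow_left _

theorem y_pow_mul_X_assoc (p : ℕ) (n : ℤ) (t : A) :
    S.y ^ p * (S.X n * t) = S.X n * (S.y ^ p * t) := by
  rw [← mul_assoc, y_pow_mul_X, mul_assoc]

theorem y_mul_X (n : ℤ) : S.y * S.X n = S.X n * S.y := S.commute_X S.x_y n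

theorem y_mul_X_assoc (n : ℤ) (t : A) : S.y * (S.X n * t) = S.X n * (S.y * t) := by
  rw [← mul_assoc, y_mul_X, mul_assoc]

theorem u_mul_X (i : ZMod m) (n : ℤ) : S.u i * S.X n = S.X (-n) * S.u i := by
  have h : SemiconjBy (S.u i) ((S.x⁻¹ : Aˣ) : A) (S.x : A) := (S.x_u i).symm
  have h2 := h.units_zpow_right (-n)
  rw [inv_zpow, ← zpow_neg, neg_neg] at h2
  exact h2.eq

theorem u_mul_X_assoc (i : ZMod m) (n : ℤ) (t : A) :
    S.u i * (S.X n * t) = S.X (-n) * (S.u i * t) := by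
  rw [← mul_assoc, u_mul_X, mul_assoc]

theorem Z_zero : S.Z 0 = 1 := by simp [Z]

theorem y_mul_u (i : ZMod m) :
    S.y * S.u i = S.u (i + 1) - chi m ξ (-(i + 1)) • (S.X d * S.u (i + 1)) := by
  rw [S.y_u, X_natCast]

variable [NeZero m]

theorem Z_natCast (n : ℕ) : S.Z n = S.z ^ n := by
  rw [Z, ZMod.val_natCast, ← pow_eq_pow_mod n S.z_pow]

theorem Z_one : S.Z 1 = S.z := by
  simpa using S.Z_natCast 1

theorem Z_mul_Z (a b : ZMod m) : S.Z a * S.Z b = S.Z (a + b) := by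
  rw [Z, Z, Z, ZMod.val_add, ← pow_eq_pow_mod _ S.z_pow, pow_add]

theorem Z_mul_Z_assoc (a b : ZMod m) (t : A) : S.Z a * (S.Z b * t) = S.Z (a + b) * t := by
  rw [← mul_assoc, Z_mul_Z]

theorem y_mul_Z (hξ : IsPrimitiveRoot ξ (2 * m)) (a : ZMod m) :
    S.y * S.Z a = chi m ξ a • (S.Z a * S.y) := by
  obtain ⟨n, rfl⟩ := ZMod.natCast_zmod_surjective a
  rw [chi_natCast hξ, Z_natCast]
  induction n with
  | zero => simp
  | succ n ih =>
    rw [pow_succ, ← mul_assoc, ih, smul_mul_assoc, mul_assoc, S.y_z, mul_smul_comm, smul_smul,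
      ← mul_assoc, pow_succ (ξ ^ 2)]

theorem y_mul_Z_assoc (hξ : IsPrimitiveRoot ξ (2 * m)) (a : ZMod m) (t : A) :
    S.y * (S.Z a * t) = chi m ξ a • (S.Z a * (S.y * t)) := by
  rw [← mul_assoc, S.y_mul_Z hξ, smul_mul_assoc, mul_assoc]

theorem y_pow_mul_Z (hξ : IsPrimitiveRoot ξ (2 * m)) (p : ℕ) (a : ZMod m) :
    S.y ^ p * S.Z a = chi m ξ (p * a) • (S.Z a * S.y ^ p) := by
  induction p with
  | zero => simp [chi_zero]
  | succ p ih =>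
    rw [pow_succ', mul_assoc, ih, mul_smul_comm, S.y_mul_Z_assoc hξ, smul_smul, ← chi_add hξ]
    congr 2
    push_cast; ring

theorem y_pow_mul_Z_assoc (hξ : IsPrimitiveRoot ξ (2 * m)) (p : ℕ) (a : ZMod m) (t : A) :
    S.y ^ p * (S.Z a * t) = chi m ξ (p * a) • (S.Z a * (S.y ^ p * t)) := by
  rw [← mul_assoc, S.y_pow_mul_Z hξ, smul_mul_assoc, mul_assoc]

theorem u_mul_Z (hξ : IsPrimitiveRoot ξ (2 * m)) (i a : ZMod m) :
    S.u i * S.Z a = chi m ξ (i * a) • (S.Z a * S.u i) := by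
  obtain ⟨n, rfl⟩ := ZMod.natCast_zmod_surjective a
  rw [Z_natCast]
  induction n with
  | zero => simp [chi_zero]
  | succ n ih =>
    rw [pow_succ, ← mul_assoc, ih, smul_mul_assoc, mul_assoc, S.u_z, mul_smul_comm, smul_smul,
      ← mul_assoc, ← chi_add hξ]
    congr 2
    push_cast; ring

theorem u_mul_Z_assoc (hξ : IsPrimitiveRoot ξ (2 * m)) (i a : ZMod m) (t : A) :
    S.u i * (S.Z a * t) = chi m ξ (i * a) • (S.Z a * (S.u i * t)) := by
  rw [← mul_assoc, S.u_mul_Z hξ, smul_mul_assoc, mul_assoc]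

/-- The relations `y_u` and `u_y`, multiplied on the left by ξ⁻¹ x^(-d). -/
theorem u_mul_y (hξ : IsPrimitiveRoot ξ (2 * m)) (i : ZMod m) :
    S.u i * S.y = ξ⁻¹ • (S.X (-d) * S.u (i + 1) - chi m ξ (-(i + 1)) • S.u (i + 1)) := by
  have h := S.u_y i
  rw [y_mul_u, ← X_natCast] at h
  have h2 := congrArg (fun t => ξ⁻¹ • (S.X (-d) * t)) h
  simp only [mul_smul_comm, smul_smul, inv_mul_cancel₀ (root_ne_zero hξ), one_smul, mul_assoc,
    X_mul_X_assoc, mul_sub, neg_add_cancel, X_zero, one_mul] at h2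
  exact h2.symm

/-- The grouplike element `g = x^d z`. -/
def g : A := S.X d * S.Z 1

theorem u_mul_u (i j : ZMod m) : S.u i * S.u j = ∑ r ∈ Finset.range (m - (i + j).val),
    ((m : k)⁻¹ * quad m ξ j * qbin (ξ ^ 2) (i + j).val r * chi m ξ (i + j - i * r)) •
      (S.X ((d : ℤ) * r + d - e) * (S.Z 1 * S.y ^ (i + j).val)) := by
  rw [Z_one]; exact S.u_u i j

end Sys

/-! ### The system of scalars defining the counit -/

theorem sum_zmod_eq_sum_range {m : ℕ} [NeZero m] {M : Type*} [AddCommMonoid M] (f : ZMod m → M) :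
    ∑ a : ZMod m, f a = ∑ n ∈ Finset.range m, f n := by
  refine Finset.sum_bij' (fun a _ => a.val) (fun n _ => (n : ZMod m)) ?_ ?_ ?_ ?_ ?_
  · intro a _; exact Finset.mem_range.mpr (ZMod.val_lt a)
  · intros; exact Finset.mem_univ _
  · intro a _; exact ZMod.natCast_zmod_val a
  · intro n hn; exact ZMod.val_cast_of_lt (Finset.mem_range.mp hn)
  · intro a _; rw [ZMod.natCast_zmod_val]

/-- The values of the counit. -/
def sysCounit [CharZero k] {m : ℕ} [NeZero m] (d e : ℕ) {ξ : k}
    (hξ : IsPrimitiveRoot ξ (2 * m)) : Sys m d e ξ k where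
  x := 1
  z := 1
  y := 0
  u i := if i = 0 then 1 else 0
  x_z := rfl
  x_y := by simp
  y_z := by simp
  z_pow := by simp
  y_pow := by simp [NeZero.ne m]
  x_u i := by simp
  y_u i := by
    by_cases h : i + 1 = 0
    · simp [h, chi_zero]
    · simp [h]
  u_y i := by simp
  u_z i := by
    by_cases h : i = 0
    · simp [h, chi_zero]
    · simp [h]
  u_u i j := by
    have hm : (m : k) ≠ 0 := Nat.cast_ne_zero.mpr (NeZero.ne m)
    -- If i + j = 0 the right side is a multiple of the character sum over r of γ^(-ir), which
    -- detects i = 0; otherwise a positive power of y = 0 kills it.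
    by_cases h : i + j = 0
    · have h1 := sum_chi_mul hξ (-i)
      rw [sum_zmod_eq_sum_range] at h1
      have h2 : ∀ r : ℕ, i + j - i * r = r * -i := by intro r; rw [h]; ring
      simp only [h2]
      simp only [h, ZMod.val_zero, qbin_zero_left, mul_one, one_zpow, Units.val_one, pow_zero,
        smul_eq_mul, Nat.sub_zero, ← Finset.mul_sum, h1, neg_eq_zero]
      by_cases hi : i = 0
      · obtain rfl : j = 0 := by simpa [hi] using h
        simp [hi, quad_zero, hm]
      · simp [hi]
    · have h1 : (i + j).val ≠ 0 := by rwa [Ne, ZMod.val_eq_zero]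
      rw [Finset.sum_eq_zero (fun r _ => by simp [h1])]
      by_cases hi : i = 0
      · have hj : j ≠ 0 := by rintro rfl; simp [hi] at h
        simp [hj]
      · simp [hi]

end Systems

end DHopf

namespace DHopf

/-! ### The coproduct -/

namespace Sys

variable {k : Type*} [Field k] {m d e : ℕ} {ξ : k} {A : Type*} [Ring A] [Algebra k A]
  (S : Sys m d e ξ A)

/-- The unit `x ⊗ x`. -/
noncomputable def xx : (A ⊗[k] A)ˣ :=
  Units.map (Algebra.TensorProduct.includeLeft : A →ₐ[k] A ⊗[k] A).toMonoidHom S.x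
    * Units.map (Algebra.TensorProduct.includeRight : A →ₐ[k] A ⊗[k] A).toMonoidHom S.x

theorem val_xx_zpow (n : ℤ) : ((S.xx ^ n : (A ⊗[k] A)ˣ) : A ⊗[k] A) = S.X n ⊗ₜ S.X n := by
  have h : Commute
      (Units.map (Algebra.TensorProduct.includeLeft : A →ₐ[k] A ⊗[k] A).toMonoidHom S.x)
      (Units.map (Algebra.TensorProduct.includeRight : A →ₐ[k] A ⊗[k] A).toMonoidHom S.x) := by
    ext; simp
  rw [xx, h.mul_zpow, ← map_zpow, ← map_zpow, Units.val_mul, Units.coe_map, Units.coe_map]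
  change (S.X n ⊗ₜ[k] (1 : A)) * ((1 : A) ⊗ₜ[k] S.X n) = _
  rw [Algebra.TensorProduct.tmul_mul_tmul, mul_one, one_mul]

theorem val_xx : (S.xx : A ⊗[k] A) = S.X 1 ⊗ₜ S.X 1 := by
  simpa using S.val_xx_zpow 1

theorem val_xx_pow (n : ℕ) : (S.xx : A ⊗[k] A) ^ n = S.X n ⊗ₜ S.X n := by
  simpa using S.val_xx_zpow n

theorem val_xx_inv : ((S.xx⁻¹ : (A ⊗[k] A)ˣ) : A ⊗[k] A) = S.X (-1) ⊗ₜ S.X (-1) := by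
  simpa using S.val_xx_zpow (-1)

variable [NeZero m]

/-- The value of the coproduct at `y`. -/
noncomputable def yy : A ⊗[k] A := S.y ⊗ₜ S.g + 1 ⊗ₜ S.y

/-- The value of the coproduct at `u_i`. -/
noncomputable def uu (i : ZMod m) : A ⊗[k] A :=
  ∑ a : ZMod m, chi m ξ (a * (i - a)) • (S.u a ⊗ₜ (S.Z a * S.u (i - a)))

theorem Z_tmul_Z_pow (n : ℕ) : (S.Z 1 ⊗ₜ[k] S.Z 1) ^ n = S.Z n ⊗ₜ S.Z n := by
  rw [Algebra.TensorProduct.tmul_pow, Z_one, Z_natCast]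

theorem sum_shift {M : Type*} [AddCommMonoid M] (f : ZMod m → M) :
    ∑ a, f a = ∑ a, f (a - 1) :=
  (Fintype.sum_equiv (Equiv.subRight (1 : ZMod m)) _ _ fun _ => rfl).symm

theorem y_mul_g (hξ : IsPrimitiveRoot ξ (2 * m)) : S.y * S.g = chi m ξ 1 • (S.g * S.y) := by
  rw [g, y_mul_X_assoc, S.y_mul_Z hξ, mul_smul_comm, mul_assoc]

theorem g_pow (n : ℕ) : S.g ^ n = S.X (d * n) * S.Z n := by
  induction n with
  | zero => simp [X_zero, Z_zero]
  | succ n ih =>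
    rw [pow_succ, ih, g, mul_assoc, Z_mul_X_assoc, X_mul_X_assoc, Z_mul_Z]
    congr 2
    push_cast; ring

/-- Each summand of Δ(y) produces a mixed term u_b ⊗ x^d z^b u_(i+1-b); after shifting the index in
the first sum, these occur with equal phases and opposite signs. -/
theorem yy_mul_uu (hξ : IsPrimitiveRoot ξ (2 * m)) (i : ZMod m) :
    S.yy * S.uu i = S.uu (i + 1)
      - chi m ξ (-(i + 1)) • ((S.xx : A ⊗[k] A) ^ d * S.uu (i + 1)) := by
  have h1 : (S.y ⊗ₜ S.g) * S.uu i = ∑ b : ZMod m, (chi m ξ ((b - 1) * (i + 1 - b)) •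
      ((S.u b - chi m ξ (-b) • (S.X d * S.u b)) ⊗ₜ[k] (S.X d * (S.Z b * S.u (i + 1 - b))))) := by
    rw [uu, sum_shift, Finset.mul_sum]
    refine Finset.sum_congr rfl fun b _ => ?_
    rw [mul_smul_comm, Algebra.TensorProduct.tmul_mul_tmul, y_mul_u, sub_add_cancel, g, mul_assoc,
      Z_mul_Z_assoc, add_sub_cancel, show i - (b - 1) = i + 1 - b by ring]
  have h2 : (1 ⊗ₜ S.y) * S.uu i = ∑ b : ZMod m, (chi m ξ (b * (i - b) + b) •
      (S.u b ⊗ₜ[k] (S.Z b * (S.u (i + 1 - b)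
        - chi m ξ (-(i + 1 - b)) • (S.X d * S.u (i + 1 - b)))))) := by
    rw [uu, Finset.mul_sum]
    refine Finset.sum_congr rfl fun b _ => ?_
    rw [mul_smul_comm, Algebra.TensorProduct.tmul_mul_tmul, one_mul, S.y_mul_Z_assoc hξ, y_mul_u,
      TensorProduct.tmul_smul, smul_smul, ← chi_add hξ, show i - b + 1 = i + 1 - b by ring]
  rw [yy, add_mul, h1, h2, ← Finset.sum_add_distrib, uu, Finset.mul_sum, Finset.smul_sum,
    ← Finset.sum_sub_distrib]
  refine Finset.sum_congr rfl fun b _ => ?_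
  rw [val_xx_pow, mul_smul_comm, Algebra.TensorProduct.tmul_mul_tmul]
  simp only [TensorProduct.tmul_sub, TensorProduct.sub_tmul, mul_sub (S.Z _), smul_sub, smul_smul,
    mul_smul_comm, TensorProduct.tmul_smul, ← TensorProduct.smul_tmul', Z_mul_X_assoc, ← chi_add hξ]
  rw [show b * (i - b) + b = b * (i + 1 - b) by ring,
    show (b - 1) * (i + 1 - b) = b * (i + 1 - b) + -(i + 1 - b) by ring,
    show b * (i + 1 - b) + -(i + 1 - b) + -b = -(i + 1) + b * (i + 1 - b) by ring]
  abel

/-- The same cancellation with y on the right; now the mixed terms are x^d u_b ⊗ z^b u_(i+1-b). -/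
theorem smul_xx_mul_uu_mul_yy (hξ : IsPrimitiveRoot ξ (2 * m)) (i : ZMod m) :
    ξ • ((S.xx : A ⊗[k] A) ^ d * S.uu i * S.yy) = S.uu (i + 1)
      - chi m ξ (-(i + 1)) • ((S.xx : A ⊗[k] A) ^ d * S.uu (i + 1)) := by
  have h0 : ∀ a, ξ • (S.X d * (S.u a * S.y))
      = S.u (a + 1) - chi m ξ (-(a + 1)) • (S.X d * S.u (a + 1)) := by
    intro a; rw [← y_mul_u, S.u_y, X_natCast, mul_assoc]
  have h1 : ξ • ((S.xx : A ⊗[k] A) ^ d * S.uu i * (S.y ⊗ₜ S.g))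
      = ∑ b : ZMod m, (chi m ξ (b * (i + 1 - b)) •
      ((S.u b - chi m ξ (-b) • (S.X d * S.u b)) ⊗ₜ[k] (S.Z b * S.u (i + 1 - b)))) := by
    rw [uu, sum_shift, Finset.mul_sum, Finset.sum_mul, Finset.smul_sum]
    refine Finset.sum_congr rfl fun b _ => ?_
    rw [val_xx_pow, mul_smul_comm, smul_mul_assoc, Algebra.TensorProduct.tmul_mul_tmul,
      Algebra.TensorProduct.tmul_mul_tmul, smul_comm, TensorProduct.smul_tmul', mul_assoc, h0,
      sub_add_cancel, g, mul_assoc, mul_assoc, u_mul_X_assoc, Z_mul_X_assoc, X_mul_X_assoc,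
      S.u_mul_Z hξ, mul_smul_comm, Z_mul_Z_assoc, mul_smul_comm, TensorProduct.tmul_smul,
      smul_smul, ← chi_add hξ, add_neg_cancel, X_zero, one_mul, sub_add_cancel,
      show i - (b - 1) = i + 1 - b by ring]
    congr 2
    ring
  have h2 : ξ • ((S.xx : A ⊗[k] A) ^ d * S.uu i * (1 ⊗ₜ S.y))
      = ∑ b : ZMod m, (chi m ξ (b * (i - b)) •
      ((S.X d * S.u b) ⊗ₜ[k] (S.Z b * (S.u (i + 1 - b)
        - chi m ξ (-(i + 1 - b)) • (S.X d * S.u (i + 1 - b)))))) := by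
    rw [uu, Finset.mul_sum, Finset.sum_mul, Finset.smul_sum]
    refine Finset.sum_congr rfl fun b _ => ?_
    rw [val_xx_pow, mul_smul_comm, smul_mul_assoc, Algebra.TensorProduct.tmul_mul_tmul,
      Algebra.TensorProduct.tmul_mul_tmul, smul_comm, ← TensorProduct.tmul_smul, mul_one,
      mul_assoc, mul_assoc, ← Z_mul_X_assoc, ← mul_smul_comm, h0,
      show i - b + 1 = i + 1 - b by ring]
  rw [yy, mul_add, smul_add, h1, h2, ← Finset.sum_add_distrib, uu, Finset.mul_sum, Finset.smul_sum,
    ← Finset.sum_sub_distrib]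
  refine Finset.sum_congr rfl fun b _ => ?_
  rw [val_xx_pow, mul_smul_comm, Algebra.TensorProduct.tmul_mul_tmul]
  simp only [TensorProduct.tmul_sub, TensorProduct.sub_tmul, mul_sub (S.Z _), smul_sub, smul_smul,
    mul_smul_comm, TensorProduct.tmul_smul, ← TensorProduct.smul_tmul', Z_mul_X_assoc, ← chi_add hξ]
  rw [show b * (i - b) + -(i + 1 - b) = -(i + 1) + b * (i + 1 - b) by ring,
    show b * (i + 1 - b) + -b = b * (i - b) by ring]
  abel

theorem yy_pow (hξ : IsPrimitiveRoot ξ (2 * m)) (n : ℕ) :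
    S.yy ^ n = ∑ p ∈ Finset.range (n + 1), qbin (ξ ^ 2) p (n - p) •
      ((S.y ^ p) ⊗ₜ[k] (S.X (d * p) * (S.Z p * S.y ^ (n - p)))) := by
  have hq : (1 ⊗ₜ S.y) * (S.y ⊗ₜ[k] S.g) = ξ ^ 2 • ((S.y ⊗ₜ[k] S.g) * (1 ⊗ₜ S.y)) := by
    simp only [Algebra.TensorProduct.tmul_mul_tmul, one_mul, mul_one, S.y_mul_g hξ,
      TensorProduct.tmul_smul]
    rw [← Nat.cast_one, chi_natCast hξ, pow_one]
  rw [yy, add_pow_of_qcomm (ξ ^ 2) _ _ hq, Finset.Nat.sum_antidiagonal_eq_sum_range_succ_mk]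
  refine Finset.sum_congr rfl fun p _ => ?_
  rw [Algebra.TensorProduct.tmul_pow, Algebra.TensorProduct.tmul_pow,
    Algebra.TensorProduct.tmul_mul_tmul, one_pow, mul_one, g_pow, mul_assoc]

/-- Only y^m ⊗ g^m + 1 ⊗ y^m survives. Since g^m = x^(md) and y^m = 1 - x^(md), the two terms
telescope. -/
theorem yy_pow_self (hξ : IsPrimitiveRoot ξ (2 * m)) :
    S.yy ^ m = 1 - (S.xx : A ⊗[k] A) ^ (m * d) := by
  obtain ⟨n, hn⟩ := Nat.exists_eq_succ_of_ne_zero (NeZero.ne m)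
  have h0 : ∀ p ∈ Finset.range n, qbin (ξ ^ 2) (p + 1) (m - (p + 1)) •
      ((S.y ^ (p + 1)) ⊗ₜ[k] (S.X (d * (p + 1 : ℕ)) * (S.Z (p + 1 : ℕ) * S.y ^ (m - (p + 1)))))
        = 0 := by
    intro p hp
    have hp := Finset.mem_range.mp hp
    obtain ⟨r, hr⟩ : ∃ r, m - (p + 1) = r + 1 := ⟨n - p - 1, by omega⟩
    rw [hr, qbin_eq_zero hξ (by omega), zero_smul]
  rw [S.yy_pow hξ, Finset.sum_range_succ', show Finset.range m = Finset.range (n + 1) by rw [hn],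
    Finset.sum_range_succ, Finset.sum_eq_zero h0, zero_add, ← Nat.succ_eq_add_one, ← hn, val_xx_pow]
  simp only [Nat.sub_self, Nat.sub_zero, qbin_zero_left, qbin_zero_right, one_smul, pow_zero,
    S.y_pow, Nat.cast_zero, mul_zero, X_zero, Z_zero, ZMod.natCast_self, mul_one, one_mul,
    ← X_natCast, Algebra.TensorProduct.one_def, TensorProduct.tmul_sub, TensorProduct.sub_tmul]
  push_cast
  rw [mul_comm (d : ℤ)]
  abel

end Sys

end DHopf

namespace DHopf

/-! ### The relation for products of the u's in the tensor square -/

namespace Sys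

variable {k : Type*} [Field k] {m d e : ℕ} {ξ : k} {A : Type*} [Ring A] [Algebra k A]
  (S : Sys m d e ξ A)

theorem natCast_eq_add_iff {m r s p : ℕ} (hs : s < m) (hr : r + p < m) :
    (s : ZMod m) = r + p ↔ s = r + p := by
  rw [← Nat.cast_add, ZMod.natCast_eq_natCast_iff', Nat.mod_eq_of_lt hs, Nat.mod_eq_of_lt hr]

/-- By `quad_add` the quadratic dependence on a cancels, leaving a constant times the character a ↦
γ^(a(s-r-P)). Orthogonality forces s ≡ r + P and absorbs one of the two factors 1/m. -/
theorem sum_phase [CharZero k] [NeZero m] (hξ : IsPrimitiveRoot ξ (2 * m)) (i j P : ZMod m)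
    (w v : k) (r s : ℕ) :
    ∑ a : ZMod m, chi m ξ (a * (i - a) + (P - a) * (j - (P - a)) + (i - a) * (P - a))
        * (((m : k)⁻¹ * quad m ξ (P - a) * w * chi m ξ (P - a * r))
          * ((m : k)⁻¹ * quad m ξ (j - (P - a)) * v * chi m ξ (i + j - P - (i - a) * s)))
      = if (s : ZMod m) = r + P then
          (m : k)⁻¹ * quad m ξ j * w * v * chi m ξ (i + j - i * r) else 0 := by
  have hm : (m : k) ≠ 0 := Nat.cast_ne_zero.mpr (NeZero.ne m)
  have h : ∀ a : ZMod m,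
      chi m ξ (a * (i - a) + (P - a) * (j - (P - a)) + (i - a) * (P - a))
        * (((m : k)⁻¹ * quad m ξ (P - a) * w * chi m ξ (P - a * r))
          * ((m : k)⁻¹ * quad m ξ (j - (P - a)) * v * chi m ξ (i + j - P - (i - a) * s)))
      = ((m : k)⁻¹ * (m : k)⁻¹ * quad m ξ j * w * v * chi m ξ (i + j + i * P - i * s))
        * chi m ξ (a * (s - r - P)) := by
    intro a
    have h1 := quad_add hξ (P - a) (j - (P - a))
    rw [add_sub_cancel] at h1
    rw [h1]
    have h2 : chi m ξ (a * (i - a) + (P - a) * (j - (P - a)) + (i - a) * (P - a))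
        * chi m ξ (P - a * r) * chi m ξ (i + j - P - (i - a) * s)
        = chi m ξ ((P - a) * (j - (P - a))) * chi m ξ (i + j + i * P - i * s)
          * chi m ξ (a * (s - r - P)) := by
      simp only [← chi_add hξ]
      congr 1
      ring
    linear_combination ((m : k)⁻¹ * (m : k)⁻¹ * quad m ξ (P - a) * quad m ξ (j - (P - a)) * w * v)
      * h2
  simp only [h, ← Finset.mul_sum, sum_chi_mul hξ]
  by_cases hs : (s : ZMod m) = r + P
  · rw [if_pos hs, if_pos (by rw [hs]; ring), hs,
      show i + j + i * P - i * (r + P) = i + j - i * r by ring]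
    field_simp
  · rw [if_neg hs, if_neg (fun h => hs (by linear_combination h)), mul_zero]

variable [NeZero m]

/-- The double sum is grouped by the total index P of the left tensor factor, which determines the
power of y occurring there. -/
theorem uu_mul_uu_eq_sum (hξ : IsPrimitiveRoot ξ (2 * m)) (i j : ZMod m) :
    S.uu i * S.uu j = ∑ P : ZMod m, ∑ a : ZMod m,
      chi m ξ (a * (i - a) + (P - a) * (j - (P - a)) + (i - a) * (P - a)) •
        ((S.u a * S.u (P - a)) ⊗ₜ[k] (S.Z P * (S.u (i - a) * S.u (j - (P - a))))) := by
  rw [uu, uu, Finset.sum_mul_sum, Finset.sum_comm (γ := ZMod m)]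
  symm
  rw [Finset.sum_comm]
  conv_rhs => rw [Finset.sum_comm]
  refine Finset.sum_congr rfl fun a _ => ?_
  refine Fintype.sum_equiv (Equiv.subRight a) _ _ fun P => ?_
  rw [Equiv.subRight_apply, smul_mul_smul_comm, Algebra.TensorProduct.tmul_mul_tmul, mul_assoc,
    S.u_mul_Z_assoc hξ, mul_smul_comm, TensorProduct.tmul_smul, Z_mul_Z_assoc, add_sub_cancel,
    smul_smul, ← chi_add hξ, ← chi_add hξ]

theorem sum_fixed_degree [CharZero k] (hξ : IsPrimitiveRoot ξ (2 * m)) (i j P : ZMod m) :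
    ∑ a : ZMod m, chi m ξ (a * (i - a) + (P - a) * (j - (P - a)) + (i - a) * (P - a)) •
        ((S.u a * S.u (P - a)) ⊗ₜ[k] (S.Z P * (S.u (i - a) * S.u (j - (P - a)))))
      = ∑ r ∈ Finset.range (m - P.val), ∑ s ∈ Finset.range (m - (i + j - P).val),
          (if (s : ZMod m) = r + P then (m : k)⁻¹ * quad m ξ j * qbin (ξ ^ 2) P.val r
            * qbin (ξ ^ 2) (i + j - P).val s * chi m ξ (i + j - i * r) else 0) •
          ((S.X (d * r + d - e) * (S.Z 1 * S.y ^ P.val)) ⊗ₜ[k]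
            (S.Z P * (S.X (d * s + d - e) * (S.Z 1 * S.y ^ (i + j - P).val)))) := by
  have h : ∀ a : ZMod m,
      chi m ξ (a * (i - a) + (P - a) * (j - (P - a)) + (i - a) * (P - a)) •
        ((S.u a * S.u (P - a)) ⊗ₜ[k] (S.Z P * (S.u (i - a) * S.u (j - (P - a)))))
      = ∑ r ∈ Finset.range (m - P.val), ∑ s ∈ Finset.range (m - (i + j - P).val),
        (chi m ξ (a * (i - a) + (P - a) * (j - (P - a)) + (i - a) * (P - a))
        * (((m : k)⁻¹ * quad m ξ (P - a) * qbin (ξ ^ 2) P.val r * chi m ξ (P - a * r))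
          * ((m : k)⁻¹ * quad m ξ (j - (P - a)) * qbin (ξ ^ 2) (i + j - P).val s
            * chi m ξ (i + j - P - (i - a) * s)))) •
          ((S.X (d * r + d - e) * (S.Z 1 * S.y ^ P.val)) ⊗ₜ[k]
            (S.Z P * (S.X (d * s + d - e) * (S.Z 1 * S.y ^ (i + j - P).val)))) := by
    intro a
    rw [u_mul_u, u_mul_u, add_sub_cancel, show i - a + (j - (P - a)) = i + j - P by ring,
      TensorProduct.sum_tmul, Finset.smul_sum]
    refine Finset.sum_congr rfl fun r _ => ?_
    rw [Finset.mul_sum, TensorProduct.tmul_sum, Finset.smul_sum]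
    refine Finset.sum_congr rfl fun s _ => ?_
    rw [mul_smul_comm, TensorProduct.tmul_smul, ← TensorProduct.smul_tmul', smul_smul, smul_smul]
    congr 1
    ring
  simp only [h]
  rw [Finset.sum_comm]
  refine Finset.sum_congr rfl fun r _ => ?_
  rw [Finset.sum_comm]
  refine Finset.sum_congr rfl fun s _ => ?_
  rw [← Finset.sum_smul, sum_phase hξ]

/-- Let n < m represent i + j. For p ≤ n the right factor has y-degree n - p, and s = r + p lies in
range exactly when r < m - n. For p > n its degree wraps around to n + m - p, so s < p - n, which is
incompatible with s = r + p. -/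
theorem sum_fixed_degree_eq [CharZero k] (hξ : IsPrimitiveRoot ξ (2 * m)) (i j : ZMod m)
    {p : ℕ} (hp : p < m) :
    ∑ a : ZMod m, chi m ξ (a * (i - a) + (p - a) * (j - (p - a)) + (i - a) * (p - a)) •
        ((S.u a * S.u (p - a)) ⊗ₜ[k] (S.Z p * (S.u (i - a) * S.u (j - (p - a)))))
      = if p < (i + j).val + 1 then ∑ r ∈ Finset.range (m - (i + j).val),
          ((m : k)⁻¹ * quad m ξ j * qbin (ξ ^ 2) (i + j).val r * chi m ξ (i + j - i * r)
            * qbin (ξ ^ 2) p ((i + j).val - p)) •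
          ((S.X (d * r + d - e) * (S.Z 1 * S.y ^ p)) ⊗ₜ[k]
            (S.X (d * r + d - e) * (S.Z 1 * (S.X (d * p) *
              (S.Z p * S.y ^ ((i + j).val - p)))))) else 0 := by
  have hn := ZMod.val_lt (i + j)
  have hpv : (p : ZMod m).val = p := ZMod.val_cast_of_lt hp
  rw [sum_fixed_degree S hξ, hpv]
  split_ifs with hpn
  · have hq : (i + j - (p : ZMod m)).val = (i + j).val - p := by
      rw [ZMod.val_sub (by rw [hpv]; omega), hpv]
    rw [hq]
    generalize (i + j).val = n at *
    have hsub : Finset.range (m - n) ⊆ Finset.range (m - p) :=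
      Finset.range_subset_range.mpr (by omega)
    rw [← Finset.sum_subset hsub]
    · refine Finset.sum_congr rfl fun r hr => ?_
      have hr := Finset.mem_range.mp hr
      rw [Finset.sum_eq_single (r + p)]
      · rw [if_pos (by push_cast; rfl)]
        have h1 := qbin_mul_qbin hξ (show p + (n - p) + r < m by omega)
        rw [show p + (n - p) = n by omega, add_comm p r] at h1
        rw [Z_mul_X_assoc, Z_mul_Z_assoc, Z_mul_X_assoc, X_mul_X_assoc, Z_mul_Z_assoc,
          add_comm (p : ZMod m) 1]
        congr 1
        · linear_combination ((m : k)⁻¹ * quad m ξ j * chi m ξ (i + j - i * r)) * h1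
        · congr 3
          push_cast; ring
      · intro s hs hne
        have hs := Finset.mem_range.mp hs
        rw [if_neg (fun h => hne ((natCast_eq_add_iff (by omega) (by omega)).mp h)), zero_smul]
      · intro h
        exact absurd (Finset.mem_range.mpr (by omega)) h
    · intro r hr1 hr2
      have hr1 := Finset.mem_range.mp hr1
      have hr2 : ¬ r < m - n := fun h => hr2 (Finset.mem_range.mpr h)
      refine Finset.sum_eq_zero fun s hs => ?_
      have hs := Finset.mem_range.mp hs
      rw [if_neg (fun h => ?_), zero_smul]
      have := (natCast_eq_add_iff (m := m) (by omega) (by omega)).mp h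
      omega
  · have hq : (i + j - (p : ZMod m)).val = (i + j).val + m - p := by
      have h1 : i + j - (p : ZMod m) = (((i + j).val + m - p : ℕ) : ZMod m) := by
        rw [Nat.cast_sub (by omega)]
        simp
      rw [h1, ZMod.val_cast_of_lt (by omega)]
    rw [hq]
    refine Finset.sum_eq_zero fun r hr => Finset.sum_eq_zero fun s hs => ?_
    have hs := Finset.mem_range.mp hs
    have hr := Finset.mem_range.mp hr
    rw [if_neg (fun h => ?_), zero_smul]
    have := (natCast_eq_add_iff (m := m) (by omega) (by omega)).mp h
    omega

/-- The surviving degrees p ≤ n carry precisely the q-binomial coefficients in the expansion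
`yy_pow`. -/
theorem uu_mul_uu [CharZero k] (hξ : IsPrimitiveRoot ξ (2 * m)) (i j : ZMod m) :
    S.uu i * S.uu j = ∑ r ∈ Finset.range (m - (i + j).val),
    ((m : k)⁻¹ * quad m ξ j * qbin (ξ ^ 2) (i + j).val r * chi m ξ (i + j - i * r)) •
      (((S.xx ^ ((d : ℤ) * r + d - e) : (A ⊗[k] A)ˣ) : A ⊗[k] A)
        * ((S.Z 1 ⊗ₜ[k] S.Z 1) * S.yy ^ (i + j).val)) := by
  have hn := ZMod.val_lt (i + j)
  rw [uu_mul_uu_eq_sum S hξ, sum_zmod_eq_sum_range]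
  rw [Finset.sum_congr rfl fun p hp => sum_fixed_degree_eq S hξ i j (Finset.mem_range.mp hp),
    ← Finset.sum_filter, show (Finset.range m).filter (fun p => p < (i + j).val + 1)
      = Finset.range ((i + j).val + 1) by ext p; simp only [Finset.mem_filter, Finset.mem_range]; omega,
    Finset.sum_comm]
  refine Finset.sum_congr rfl fun r _ => ?_
  rw [S.yy_pow hξ, Finset.mul_sum, Finset.mul_sum, Finset.smul_sum]
  refine Finset.sum_congr rfl fun p _ => ?_
  rw [val_xx_zpow, mul_smul_comm, mul_smul_comm, smul_smul, Algebra.TensorProduct.tmul_mul_tmul,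
    Algebra.TensorProduct.tmul_mul_tmul]

/-- The values of the coproduct. -/
noncomputable def tensor [CharZero k] (hξ : IsPrimitiveRoot ξ (2 * m)) :
    Sys m d e ξ (A ⊗[k] A) where
  x := S.xx
  z := S.Z 1 ⊗ₜ S.Z 1
  y := S.yy
  u := S.uu
  x_z := by
    rw [val_xx, Algebra.TensorProduct.tmul_mul_tmul, Algebra.TensorProduct.tmul_mul_tmul, Z_mul_X]
  x_y := by
    simp only [val_xx, yy, mul_add, add_mul, Algebra.TensorProduct.tmul_mul_tmul, mul_one, one_mul,
      y_mul_X, g, Z_mul_X, mul_assoc, X_mul_X_assoc, add_comm (1 : ℤ)]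
  y_z := by
    have h : ξ ^ 2 = chi m ξ 1 := by rw [← Nat.cast_one, chi_natCast hξ, pow_one]
    simp only [h, yy, mul_add, add_mul, Algebra.TensorProduct.tmul_mul_tmul, mul_one, one_mul,
      S.y_mul_Z hξ, g, Z_mul_X_assoc, mul_assoc, Z_mul_Z, TensorProduct.tmul_smul, smul_add,
      TensorProduct.smul_tmul']
  z_pow := by
    rw [Z_tmul_Z_pow, ZMod.natCast_self, Z_zero, Algebra.TensorProduct.one_def]
  y_pow := S.yy_pow_self hξ
  x_u i := by
    simp only [val_xx, val_xx_inv, uu, Finset.mul_sum, Finset.sum_mul, mul_smul_comm,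
      smul_mul_assoc, Algebra.TensorProduct.tmul_mul_tmul, mul_assoc, u_mul_X, Z_mul_X_assoc,
      neg_neg]
  y_u i := S.yy_mul_uu hξ i
  u_y i := by rw [S.yy_mul_uu hξ, S.smul_xx_mul_uu_mul_yy hξ]
  u_z i := by
    simp only [uu, Finset.mul_sum, Finset.sum_mul, Finset.smul_sum, mul_smul_comm,
      smul_mul_assoc, Algebra.TensorProduct.tmul_mul_tmul, mul_assoc, S.u_mul_Z hξ,
      Z_mul_Z_assoc, TensorProduct.tmul_smul, ← TensorProduct.smul_tmul', smul_smul, ← chi_add hξ]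
    refine Finset.sum_congr rfl fun a _ => ?_
    rw [add_comm a 1]
    congr 2
    ring
  u_u i j := S.uu_mul_uu hξ i j

end Sys

end DHopf

namespace DHopf

/-! ### The scalar occurring in the antipode -/

section Phases

variable {k : Type*} [Field k] {m : ℕ} [NeZero m] {ξ : k}

/-- The scalar in the value of the antipode at `u_i`. -/
def sphase (m : ℕ) (ξ : k) (i : ZMod m) : k := (quad m ξ i)⁻¹ * chi m ξ (-i)

theorem sphase_succ (hξ : IsPrimitiveRoot ξ (2 * m)) (i : ZMod m) :
    sphase m ξ (i + 1) = -(sphase m ξ i * ξ⁻¹ * chi m ξ (-(i + 1))) := by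
  have h1 : quad m ξ 1 = -ξ := by
    rw [← Nat.cast_one, quad_natCast hξ]; simp
  rw [sphase, sphase, quad_add hξ, h1, mul_one, chi_neg hξ i, mul_inv, mul_inv, inv_neg]
  ring

theorem xi_mul_chi_neg_one (hξ : IsPrimitiveRoot ξ (2 * m)) : ξ * chi m ξ (-1) = ξ⁻¹ := by
  have h := root_ne_zero hξ
  rw [chi_neg hξ, ← Nat.cast_one, chi_natCast hξ]
  field_simp

theorem sphase_mul_quad (hξ : IsPrimitiveRoot ξ (2 * m)) (i : ZMod m) :
    sphase m ξ i * quad m ξ i = chi m ξ (-i) := by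
  have h := quad_ne_zero hξ i
  rw [sphase]; field_simp

theorem sphase_eq (hξ : IsPrimitiveRoot ξ (2 * m)) (i : ZMod m) :
    sphase m ξ i = quad m ξ i * chi m ξ (-(i * i) - i) := by
  have h := quad_ne_zero hξ i
  have h2 := chi_ne_zero hξ (i * i)
  rw [sphase, inv_mul_eq_iff_eq_mul₀ h, ← mul_assoc, quad_sq hξ, ← chi_add hξ]
  congr 1
  ring

theorem sphase_natCast (hξ : IsPrimitiveRoot ξ (2 * m)) (i : ℕ) : sphase m ξ (i : ZMod m)
    = (-1 : k) ^ i * ξ ^ (-(i : ℤ)) * (ξ ^ 2) ^ (-((i : ℤ) * ((i : ℤ) + 1) / 2)) := by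
  have h0 := root_ne_zero hξ
  have h2 : ((-1 : k) ^ i)⁻¹ = (-1) ^ i := by rw [← inv_pow, inv_neg_one]
  have h3 : (ξ ^ 2) ^ (-((i : ℤ) * ((i : ℤ) + 1) / 2)) = (ξ ^ (i * (i + 1)))⁻¹ := by
    have h4 : (i : ℤ) * ((i : ℤ) + 1) / 2 = ((i * (i + 1) / 2 : ℕ) : ℤ) := by push_cast; rfl
    rw [h4, zpow_neg, zpow_natCast, ← pow_mul,
      Nat.mul_div_cancel' (Nat.even_mul_succ_self i).two_dvd]
  rw [sphase, quad_natCast hξ, chi_neg hξ, chi_natCast hξ, h3, mul_inv, h2, zpow_neg, zpow_natCast,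
    ← pow_mul]
  field_simp
  ring

end Phases

namespace Sys

variable {k : Type*} [Field k] {m d e : ℕ} {ξ : k} {A : Type*} [Ring A] [Algebra k A]
  (S : Sys m d e ξ A)

/-! ### The antipode -/

/-- The value of the antipode at `y`, that is `-y g⁻¹`. -/
def ya : A := -(S.y * (S.X (-d) * S.Z (-1)))

/-- The value of the antipode at `u_i`. -/
def ua (i : ZMod m) : A := sphase m ξ i • (S.X (d - e) * (S.Z (-1 - i) * S.u i))

theorem ya_mul_X (n : ℤ) : S.ya * S.X n = S.X n * S.ya := by
  simp only [ya, neg_mul, mul_neg, mul_assoc, Z_mul_X, y_mul_X_assoc, X_mul_X_assoc,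
    add_comm n]

theorem ua_mul_X (i : ZMod m) (n : ℤ) : S.ua i * S.X n = S.X (-n) * S.ua i := by
  simp only [ua, smul_mul_assoc, mul_smul_comm, mul_assoc, Z_mul_X_assoc, u_mul_X, X_mul_X_assoc,
    add_comm (-n)]

open MulOpposite in
theorem val_opUnit_zpow (n : ℤ) :
    ((Units.opEquiv.symm (op S.x⁻¹) ^ n : Aᵐᵒᵖˣ) : Aᵐᵒᵖ) = op (S.X (-n)) := by
  rw [← map_zpow, ← op_zpow, Units.coe_opEquiv_symm, unop_op, inv_zpow, ← zpow_neg, X]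

variable [NeZero m]

theorem ya_eq (hξ : IsPrimitiveRoot ξ (2 * m)) :
    S.ya = -(chi m ξ (-1) • (S.X (-d) * (S.Z (-1) * S.y))) := by
  rw [ya, y_mul_X_assoc, S.y_mul_Z hξ, mul_smul_comm]

/-- Moving the next x^(-d) z⁻¹ to the left of the y's costs -γ^(-(p+1)), and these factors multiply
to the inverse of `tri`. -/
theorem ya_pow (hξ : IsPrimitiveRoot ξ (2 * m)) (p : ℕ) :
    S.ya ^ p = (tri ξ p)⁻¹ • (S.X (-(d * p)) * (S.Z (-p) * S.y ^ p)) := by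
  induction p with
  | zero => simp [tri_zero, X_zero, Z_zero]
  | succ p ih =>
    rw [pow_succ, ih, S.ya_eq hξ]
    have h1 : chi m ξ (-1) * chi m ξ (p * -1) = ((ξ ^ 2) ^ (p + 1))⁻¹ := by
      rw [← chi_add hξ, ← chi_natCast hξ, ← chi_neg hξ]
      congr 1
      push_cast; ring
    rw [tri_succ, mul_inv, inv_neg, ← h1]
    simp only [mul_neg (_ • _), smul_mul_assoc, mul_smul_comm, mul_assoc, y_pow_mul_X_assoc,
      S.y_pow_mul_Z_assoc hξ, Z_mul_X_assoc, X_mul_X_assoc, Z_mul_Z_assoc, smul_smul, ← pow_succ,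
      neg_mul, neg_smul, neg_inj]
    rw [show -((d : ℤ) * p) + -d = -(d * (p + 1 : ℕ)) by push_cast; ring,
      show -(p : ZMod m) + -1 = -((p + 1 : ℕ) : ZMod m) by push_cast; ring]
    congr 1
    ring

/-- This is `y_u` read in the opposite algebra, where products are reversed and x^(-d) plays the
part of x^d. -/
theorem ua_mul_ya (hξ : IsPrimitiveRoot ξ (2 * m)) (i : ZMod m) :
    S.ua i * S.ya = S.ua (i + 1) - chi m ξ (-(i + 1)) • (S.ua (i + 1) * S.X (-d)) := by
  rw [ua_mul_X, ua, ua, sphase_succ hξ, ya]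
  simp only [mul_neg (_ • _), smul_mul_assoc, mul_assoc, neg_smul]
  rw [← mul_assoc (S.u i), S.u_mul_y hξ]
  simp only [smul_mul_assoc, mul_smul_comm, sub_mul, mul_sub, smul_sub, smul_smul, mul_assoc,
    u_mul_X_assoc, S.u_mul_Z hξ, Z_mul_X_assoc, X_mul_X_assoc, Z_mul_Z_assoc, mul_neg (S.X _)]
  rw [show (i + 1) * -1 = -(i + 1) by ring, show -1 - i + -1 = -1 - (i + 1) by ring,
    show (d : ℤ) - e + (-d + -(-d)) = d - e by ring,
    show -(-(d : ℤ)) + (d - e) = d - e + -(-d) by ring]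
  module

theorem ya_mul_ua (hξ : IsPrimitiveRoot ξ (2 * m)) (i : ZMod m) :
    S.ua i * S.ya = ξ • (S.ya * (S.ua i * S.X (-d))) := by
  rw [ua_mul_ya S hξ, ua_mul_X, ua_mul_X, ← mul_assoc, ya_mul_X, S.ya_eq hξ, ua, ua,
    sphase_succ hξ]
  simp only [mul_neg, neg_mul, smul_mul_assoc, mul_smul_comm, mul_assoc, Z_mul_X_assoc, neg_smul,
    y_mul_X_assoc, S.y_mul_Z_assoc hξ, Z_mul_Z_assoc, X_mul_X_assoc, y_mul_u, mul_sub, smul_sub,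
    smul_smul]
  rw [show (-1 : ZMod m) + (-1 - i) = -1 - (i + 1) by ring, show -1 - i = -(i + 1) by ring,
    show - -(d : ℤ) + -d + (d - e) = d - e by ring,
    show - -(d : ℤ) + -d + (d - e + d) = - -d + (d - e) by ring,
    ← xi_mul_chi_neg_one hξ]
  module

/-- The antipode inverts x, so the powers of x^d on the right run in the opposite direction to those
in the expansion of u_j u_i. Summing backwards, with p + r + s + 1 = m for p representing i + j,
matches the exponents through 2e = (1+m)d and the coefficients through `qbin_reflect`. -/
theorem ua_mul_ua (hξ : IsPrimitiveRoot ξ (2 * m)) (he : 2 * e = (1 + m) * d) (i j : ZMod m) :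
    S.ua j * S.ua i = ∑ r ∈ Finset.range (m - (i + j).val),
      ((m : k)⁻¹ * quad m ξ j * qbin (ξ ^ 2) (i + j).val r * chi m ξ (i + j - i * r)) •
        ((S.ya ^ (i + j).val * S.Z (-1)) * S.X (-((d : ℤ) * r + d - e))) := by
  have hn := ZMod.val_lt (i + j)
  have hc : ((i + j).val : ZMod m) = i + j := ZMod.natCast_zmod_val _
  rw [S.ya_pow hξ, ua, ua, smul_mul_smul_comm]
  simp only [mul_assoc, u_mul_X_assoc, Z_mul_X_assoc, X_mul_X_assoc, S.u_mul_Z_assoc hξ,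
    mul_smul_comm, Z_mul_Z_assoc, smul_mul_assoc, S.y_pow_mul_Z_assoc hξ, y_pow_mul_X,
    smul_smul]
  rw [u_mul_u, add_comm j i, ← Finset.sum_range_reflect, Finset.mul_sum, Finset.mul_sum,
    Finset.smul_sum]
  refine Finset.sum_congr rfl fun r hr => ?_
  have hr := Finset.mem_range.mp hr
  have hs : (i + j).val + r + (m - (i + j).val - 1 - r) + 1 = m := by omega
  generalize m - (i + j).val - 1 - r = s at hs ⊢
  have hsc : (s : ZMod m) = -(i + j) - r - 1 := by
    have h0 := congrArg (Nat.cast (R := ZMod m)) hs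
    push_cast at h0
    rw [hc, ZMod.natCast_self m] at h0
    linear_combination h0
  have hr2 := qbin_reflect hξ hs
  rw [← chi_natCast hξ] at hr2
  push_cast at hr2
  rw [hc] at hr2 ⊢
  simp only [mul_smul_comm, smul_smul, Z_mul_X_assoc, X_mul_X_assoc, Z_mul_Z_assoc]
  have hX : (d : ℤ) - e + -(d - e) + (d * s + d - e)
      = -(d * (i + j).val) + -(d * r + d - e) := by
    zify at he hs
    linear_combination (d : ℤ) * hs - he
  rw [hX, show -1 - j + (-1 - i) + 1 = -(i + j) + -1 by ring]
  congr 1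
  rw [← hr2]
  have ht := tri_ne_zero hξ (i + j).val
  have e1 : sphase m ξ j * sphase m ξ i * quad m ξ i
      = quad m ξ j * chi m ξ (-(j * j) - j) * chi m ξ (-i) := by
    rw [mul_assoc, sphase_mul_quad hξ, sphase_eq hξ]
  have e2 : chi m ξ (-(j * j) - j) * chi m ξ (-i) * chi m ξ (j * (-1 - i))
      * chi m ξ (i + j - j * s) = chi m ξ ((i + j) * r) * chi m ξ (i + j - i * r)
        * chi m ξ ((i + j) * -1) := by
    simp only [← chi_add hξ]
    congr 1
    rw [hsc]; ring
  have e3 := mul_inv_cancel₀ ht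
  linear_combination ((m : k)⁻¹ * qbin (ξ ^ 2) (i + j).val s * chi m ξ (j * (-1 - i))
      * chi m ξ (i + j - j * s)) * e1
    + (m : k)⁻¹ * qbin (ξ ^ 2) (i + j).val s * quad m ξ j * e2
    - (m : k)⁻¹ * qbin (ξ ^ 2) (i + j).val s * quad m ξ j * chi m ξ ((i + j) * r)
      * chi m ξ (i + j - i * r) * chi m ξ ((i + j) * -1) * e3

open MulOpposite in
/-- The values of the antipode. -/
noncomputable def opposite (hξ : IsPrimitiveRoot ξ (2 * m)) (he : 2 * e = (1 + m) * d) :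
    Sys m d e ξ Aᵐᵒᵖ :=
  have hx : ((Units.opEquiv.symm (op S.x⁻¹) : Aᵐᵒᵖˣ) : Aᵐᵒᵖ) = op (S.X (-1)) := by
    simpa using S.val_opUnit_zpow 1
  have hxi : (((Units.opEquiv.symm (op S.x⁻¹))⁻¹ : Aᵐᵒᵖˣ) : Aᵐᵒᵖ) = op (S.X 1) := by
    simpa using S.val_opUnit_zpow (-1)
  have hxp (n : ℕ) : ((Units.opEquiv.symm (op S.x⁻¹) : Aᵐᵒᵖˣ) : Aᵐᵒᵖ) ^ n = op (S.X (-n)) := by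
    simpa using S.val_opUnit_zpow n
  { x := Units.opEquiv.symm (op S.x⁻¹)
    z := op (S.Z (-1))
    y := op S.ya
    u i := op (S.ua i)
    x_z := by rw [hx, ← op_mul, ← op_mul, Z_mul_X]
    x_y := by rw [hx, ← op_mul, ← op_mul, ya_mul_X]
    y_z := by
      rw [← op_mul, ← op_mul, ← op_smul, S.ya_eq hξ]
      have h : ξ ^ 2 * chi m ξ (-1) = 1 := by
        rw [← pow_one (ξ ^ 2), ← chi_natCast hξ, ← chi_add hξ, Nat.cast_one, add_neg_cancel,
          chi_zero]
      simp only [mul_neg, neg_mul, smul_mul_assoc, mul_smul_comm, mul_assoc, Z_mul_X_assoc,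
        S.y_mul_Z hξ, Z_mul_Z_assoc, smul_neg, smul_smul]
      rw [show ξ ^ 2 * (chi m ξ (-1) * chi m ξ (-1)) = chi m ξ (-1) by
        rw [← mul_assoc, h, one_mul]]
    z_pow := by
      rw [← op_pow, Z, ← pow_mul, mul_comm, pow_mul, S.z_pow, one_pow, op_one]
    y_pow := by
      rw [hxp, ← op_pow, S.ya_pow hξ, tri_self hξ, S.y_pow, ← X_natCast, ← op_one, ← op_sub]
      congr 1
      simp only [ZMod.natCast_self, neg_zero, Z_zero, one_mul, mul_sub, mul_one, X_mul_X]
      rw [show -((d : ℤ) * m) + (m * d : ℕ) = 0 by push_cast; ring, X_zero,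
        show -((d : ℤ) * m) = -((m * d : ℕ) : ℤ) by push_cast; ring]
      norm_num
    x_u i := by rw [hx, hxi, ← op_mul, ← op_mul, ua_mul_X, neg_neg]
    y_u i := by rw [hxp, ← op_mul, ← op_mul, ← op_smul, ← op_sub, S.ua_mul_ya hξ]
    u_y i := by rw [hxp, ← op_mul, ← op_mul, ← op_mul, ← op_smul, S.ya_mul_ua hξ]
    u_z i := by
      rw [← op_mul, ← op_mul, ← op_smul, ua]
      simp only [smul_mul_assoc, mul_smul_comm, mul_assoc, Z_mul_X_assoc, S.u_mul_Z hξ,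
        Z_mul_Z_assoc, smul_smul]
      rw [mul_comm (chi m ξ i), mul_assoc, ← chi_add hξ, mul_neg_one, neg_add_cancel, chi_zero,
        mul_one, add_comm (-1 : ZMod m)]
    u_u i j := by
      simp only [S.val_opUnit_zpow, ← op_pow, ← op_mul, ← op_smul, ← Finset.op_sum,
        S.ua_mul_ua hξ he] }

/-- The dependence on a is the character a ↦ γ^(a(-1-r)), so only r = m - 1 can survive, and the
range of r then forces i = 0. The remaining power of x has exponent (1+m)d - 2e = 0. -/
theorem sum_ua_mul_u [CharZero k] (hξ : IsPrimitiveRoot ξ (2 * m)) (he : 2 * e = (1 + m) * d)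
    (i : ZMod m) :
    ∑ a : ZMod m, chi m ξ (a * (i - a)) • (S.ua a * (S.Z a * S.u (i - a)))
      = if i = 0 then 1 else 0 := by
  have hm : (m : k) ≠ 0 := Nat.cast_ne_zero.mpr (NeZero.ne m)
  have hi := ZMod.val_lt i
  have h1 : ∀ a : ZMod m, chi m ξ (a * (i - a)) • (S.ua a * (S.Z a * S.u (i - a)))
      = ∑ r ∈ Finset.range (m - i.val), ((m : k)⁻¹ * quad m ξ i * qbin (ξ ^ 2) i.val r
        * chi m ξ i * chi m ξ (a * (-1 - r))) • (S.X (d * r + d - e + (d - e)) * S.y ^ i.val) := by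
    intro a
    simp only [ua, smul_mul_assoc, mul_assoc, S.u_mul_Z_assoc hξ, mul_smul_comm, smul_smul,
      Z_mul_Z_assoc, u_mul_u, add_sub_cancel, Finset.mul_sum, Finset.smul_sum]
    refine Finset.sum_congr rfl fun r _ => ?_
    rw [Z_mul_X_assoc, X_mul_X_assoc, Z_mul_Z_assoc, show -1 - a + a + 1 = 0 by ring, Z_zero,
      one_mul, add_comm ((d : ℤ) - e)]
    congr 1
    have e1 := quad_add hξ a (i - a)
    rw [add_sub_cancel] at e1
    have e2 : chi m ξ (-(a * a) - a) * chi m ξ (a * a) * chi m ξ (i - a * r)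
        = chi m ξ i * chi m ξ (a * (-1 - r)) := by
      simp only [← chi_add hξ]
      congr 1
      ring
    rw [sphase_eq hξ, e1]
    linear_combination ((m : k)⁻¹ * quad m ξ a * quad m ξ (i - a) * qbin (ξ ^ 2) i.val r
      * chi m ξ (a * (i - a))) * e2
  simp only [h1]
  rw [Finset.sum_comm]
  simp only [← Finset.sum_smul, ← Finset.mul_sum, sum_chi_mul hξ]
  have h2 : ∀ r : ℕ, (-1 - (r : ZMod m) = 0) ↔ m ∣ r + 1 := by
    intro r
    rw [← ZMod.natCast_eq_zero_iff]
    push_cast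
    constructor <;> intro h <;> linear_combination -h
  simp only [h2]
  split_ifs with h0
  · subst h0
    rw [ZMod.val_zero, Nat.sub_zero, Finset.sum_eq_single (m - 1)]
    · have h3 : m - 1 + 1 = m := Nat.sub_add_cancel (NeZero.pos m)
      rw [if_pos (by rw [h3]), qbin_zero_left, quad_zero, chi_zero,
        show (d : ℤ) * (m - 1 : ℕ) + d - e + (d - e) = 0 by
          zify at he h3
          linear_combination (d : ℤ) * h3 - he, X_zero]
      simp [hm]
    · intro r hr hne
      have hr := Finset.mem_range.mp hr
      rw [if_neg (fun h => hne ?_), mul_zero, zero_smul]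
      have := Nat.le_of_dvd (by omega) h
      omega
    · intro h
      exact absurd (Finset.mem_range.mpr (Nat.sub_lt (NeZero.pos m) one_pos)) h
  · refine Finset.sum_eq_zero fun r hr => ?_
    have hr := Finset.mem_range.mp hr
    have h3 : i.val ≠ 0 := by rwa [Ne, ZMod.val_eq_zero]
    rw [if_neg (fun h => ?_), mul_zero, zero_smul]
    have := Nat.le_of_dvd (by omega) h
    omega

/-- Here the character is a ↦ γ^(a(-i-r)). Survival means m ∣ `i.val + r`, which within the range of
r happens only for i = 0 and r = 0. -/
theorem sum_u_mul_ua [CharZero k] (hξ : IsPrimitiveRoot ξ (2 * m)) (i : ZMod m) :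
    ∑ a : ZMod m, chi m ξ (a * (i - a)) • (S.u a * (S.ua (i - a) * S.Z (-a)))
      = if i = 0 then 1 else 0 := by
  have hm : (m : k) ≠ 0 := Nat.cast_ne_zero.mpr (NeZero.ne m)
  have hi := ZMod.val_lt i
  have h1 : ∀ a : ZMod m, chi m ξ (a * (i - a)) • (S.u a * (S.ua (i - a) * S.Z (-a)))
      = ∑ r ∈ Finset.range (m - i.val), ((m : k)⁻¹ * qbin (ξ ^ 2) i.val r
        * chi m ξ (a * (-i - r))) • (S.X (d * r) * (S.Z (-i) * S.y ^ i.val)) := by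
    intro a
    simp only [ua, smul_mul_assoc, mul_assoc, S.u_mul_Z hξ, S.u_mul_Z_assoc hξ, mul_smul_comm,
      smul_smul, Z_mul_Z_assoc, u_mul_X_assoc, u_mul_u, add_sub_cancel, Finset.mul_sum,
      Finset.smul_sum]
    refine Finset.sum_congr rfl fun r _ => ?_
    rw [Z_mul_X_assoc, X_mul_X_assoc, Z_mul_Z_assoc,
      show -1 - (i - a) + -a + 1 = -i by ring,
      show -((d : ℤ) - e) + (d * r + d - e) = d * r by ring]
    congr 1
    have e1 := sphase_mul_quad hξ (i - a)
    have e2 : chi m ξ (a * (i - a)) * chi m ξ (-(i - a)) * chi m ξ ((i - a) * -a)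
        * chi m ξ (a * (-1 - (i - a) + -a)) * chi m ξ (i - a * r)
        = chi m ξ (a * (-i - r)) := by
      simp only [← chi_add hξ]
      congr 1
      ring
    rw [← e2, ← e1]
    ring
  simp only [h1]
  rw [Finset.sum_comm]
  simp only [← Finset.sum_smul, ← Finset.mul_sum, sum_chi_mul hξ]
  have h2 : ∀ r : ℕ, (-i - (r : ZMod m) = 0) ↔ m ∣ i.val + r := by
    intro r
    rw [← ZMod.natCast_eq_zero_iff]
    push_cast
    rw [ZMod.natCast_zmod_val]
    constructor <;> intro h <;> linear_combination -h
  simp only [h2]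
  split_ifs with h0
  · subst h0
    rw [ZMod.val_zero, Nat.sub_zero, Finset.sum_eq_single 0]
    · simp [qbin_zero_left, X_zero, Z_zero, hm]
    · intro r hr hne
      have hr := Finset.mem_range.mp hr
      rw [if_neg (fun h => ?_), mul_zero, zero_smul]
      have := Nat.le_of_dvd (by omega) h
      omega
    · intro h
      exact absurd (Finset.mem_range.mpr (NeZero.pos m)) h
  · refine Finset.sum_eq_zero fun r hr => ?_
    have hr := Finset.mem_range.mp hr
    have h3 : i.val ≠ 0 := by rwa [Ne, ZMod.val_eq_zero]
    rw [if_neg (fun h => ?_), mul_zero, zero_smul]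
    have := Nat.le_of_dvd (by omega) h
    omega

end Sys

end DHopf

namespace DHopf

/-! ### The algebra `D(m,d,ξ)` represents systems -/

section Lift

variable {k : Type*} [Field k] {m d e : ℕ} {ξ : k}

/-- The exponents of ξ add up to -j + j(j+1) = j². -/
theorem coef_eq [NeZero m] (hξ : IsPrimitiveRoot ξ (2 * m)) (j : ℕ) :
    coef m ξ j = (m : k)⁻¹ * quad m ξ j := by
  have h := root_ne_zero hξ
  have h2 : ((-1 : k) ^ j)⁻¹ = (-1) ^ j := by rw [← inv_pow, inv_neg_one]
  rw [coef, quad_natCast hξ, ← pow_mul, Nat.mul_div_cancel' (Nat.even_mul_succ_self j).two_dvd,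
    zpow_neg, zpow_neg, zpow_natCast, zpow_natCast, h2, mul_add, pow_add, mul_one, ← sq]
  field_simp

/-- The product of the `φ_s` over `i ≤ s < i + N` in a `k`-algebra, with `T` in place of `x^d`. -/
noncomputable def phiProd {A : Type*} [Ring A] [Algebra k A] (ξ : k) (T : A) (i N : ℕ) : A :=
  ((List.range' i N).map fun s : ℕ => 1 - (ξ ^ 2) ^ (-(s : ℤ) - 1) • T).prod

theorem map_fphi {A : Type*} [Ring A] [Algebra k A] (F : Free k m →ₐ[k] A) (i : ℕ) :
    F (fphi m d ξ i) = 1 - (ξ ^ 2) ^ (-(i : ℤ) - 1) • F (fx k m) ^ d := by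
  rw [fphi, map_sub, map_one, map_smul, map_pow]

theorem map_fphiProd {A : Type*} [Ring A] [Algebra k A] (F : Free k m →ₐ[k] A) (a b : ℕ) :
    F (fphiProd m d ξ a b) = phiProd ξ (F (fx k m) ^ d) a (b - a) := by
  rw [fphiProd, map_list_prod, List.map_map, phiProd]
  simp only [Function.comp_def, map_fphi]

/-- Since γ^m = 1, the factors are periodic in their index, so a product that wraps past m - 1 is
one consecutive product. This puts the case i + j ≥ m in the form of the others. -/
theorem phiProd_mul_phiProd [NeZero m] (hξ : IsPrimitiveRoot ξ (2 * m)) {A : Type*} [Ring A]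
    [Algebra k A] (T : A) {i M N : ℕ} (hi : i + M = m) :
    phiProd ξ T i M * phiProd ξ T 0 N = phiProd ξ T i (M + N) := by
  have h : ∀ s : ℕ, (1 : A) - (ξ ^ 2) ^ (-((m + s : ℕ) : ℤ) - 1) • T
      = 1 - (ξ ^ 2) ^ (-(s : ℤ) - 1) • T := by
    intro s
    rw [← chi_intCast hξ, ← chi_intCast hξ]
    push_cast
    rw [ZMod.natCast_self, zero_add]
  rw [phiProd, phiProd, phiProd, ← List.range'_append_1, List.map_append, List.prod_append, hi,
    show m = m + 0 from rfl,
    ← List.map_add_range', List.map_map]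
  simp only [Function.comp_def, h]

/-- The dictionary between the relation as presented, with g = x^d z, and its expanded form in
`Sys`. In all three cases the number N of φ-factors and the y-degree p satisfy N + p + 1 = m. -/
theorem smul_phiProd_eq_sum [NeZero m] (hξ : IsPrimitiveRoot ξ (2 * m)) {A : Type*} [Ring A]
    [Algebra k A] (x : Aˣ) {z y : A} (hxy : (x : A) * y = y * x)
    (hyz : y * z = ξ ^ 2 • (z * y)) (e : ℕ) {i j p N : ℕ} (h : N + p + 1 = m)
    (hp : (p : ZMod m) = i + j) :
    coef m ξ j • (((x⁻¹ : Aˣ) : A) ^ e * phiProd ξ ((x : A) ^ d) i N * y ^ p * ((x : A) ^ d * z))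
      = ∑ r ∈ Finset.range (m - p),
        ((m : k)⁻¹ * quad m ξ j * qbin (ξ ^ 2) p r * chi m ξ (i + j - i * r)) •
          (((x ^ ((d : ℤ) * r + d - e) : Aˣ) : A) * (z * y ^ p)) := by
  have h1 : y ^ p * ((x : A) ^ d * z) = (ξ ^ 2) ^ p • ((x : A) ^ d * (z * y ^ p)) := by
    have h2 : y ^ p * z = (ξ ^ 2) ^ p • (z * y ^ p) := by
      clear h hp
      induction p with
      | zero => simp
      | succ p ih =>
        rw [pow_succ', mul_assoc, ih, mul_smul_comm, ← mul_assoc, hyz, smul_mul_assoc, smul_smul,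
          ← pow_succ, mul_assoc]
    rw [← mul_assoc, ((show Commute (x : A) y from hxy).symm.pow_pow p d).eq, mul_assoc, h2,
      mul_smul_comm]
  rw [mul_assoc, h1, phiProd, prod_range'_eq_sum hξ _ _ h, coef_eq hξ, Finset.mul_sum,
    Finset.sum_mul, Finset.smul_sum]
  refine Finset.sum_congr rfl fun r _ => ?_
  have h3 : ((x⁻¹ : Aˣ) : A) ^ e * ((x : A) ^ d) ^ r * (x : A) ^ d
      = ((x ^ ((d : ℤ) * r + d - e) : Aˣ) : A) := by
    rw [← pow_mul, mul_assoc, ← pow_add, ← Units.val_pow_eq_pow_val, ← Units.val_pow_eq_pow_val,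
      ← Units.val_mul, inv_pow, ← zpow_natCast, ← zpow_natCast, ← zpow_neg, ← zpow_add]
    congr 2
    push_cast; ring
  rw [mul_smul_comm, mul_smul_comm, smul_mul_assoc, smul_smul, smul_smul, ← mul_assoc _ _ (z * y ^ p), h3,
    ← chi_natCast hξ, hp]
  congr 1
  rw [show (i : ZMod m) + j - i * r = -(i * r) + (i + j) by ring, chi_add hξ (-(i * r))]
  ring

namespace Sys

variable {A : Type*} [Ring A] [Algebra k A] (S : Sys m d e ξ A)

/-- The images of the generators. -/
noncomputable def gen [NeZero m] : Gen m → A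
  | .x => S.x
  | .xinv => (S.x⁻¹ : Aˣ)
  | .g => (S.x : A) ^ d * S.z
  | .y => S.y
  | .u a => S.u a

/-- The homomorphism from the free algebra. -/
noncomputable def freeLift [NeZero m] : Free k m →ₐ[k] A := FreeAlgebra.lift k S.gen

variable [NeZero m]

theorem freeLift_x : S.freeLift (fx k m) = S.x := FreeAlgebra.lift_ι_apply _ _

theorem freeLift_xinv : S.freeLift (fxinv k m) = (S.x⁻¹ : Aˣ) := FreeAlgebra.lift_ι_apply _ _

theorem freeLift_g : S.freeLift (fg k m) = (S.x : A) ^ d * S.z := FreeAlgebra.lift_ι_apply _ _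

theorem freeLift_y : S.freeLift (fy k m) = S.y := FreeAlgebra.lift_ι_apply _ _

theorem freeLift_u (s : ℤ) : S.freeLift (fu k m s) = S.u s := FreeAlgebra.lift_ι_apply _ _

theorem g_eq : S.g = (S.x : A) ^ d * S.z := by rw [g, X_natCast, Z_one]

theorem u_mul_u_natCast (hξ : IsPrimitiveRoot ξ (2 * m)) {i j p N : ℕ} (h : N + p + 1 = m)
    (hp : (p : ZMod m) = i + j) :
    S.u i * S.u j = coef m ξ j • (((S.x⁻¹ : Aˣ) : A) ^ e * phiProd ξ ((S.x : A) ^ d) i N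
      * S.y ^ p * ((S.x : A) ^ d * S.z)) := by
  have hv : ((i : ZMod m) + j).val = p := by rw [← hp, ZMod.val_cast_of_lt (by omega)]
  rw [smul_phiProd_eq_sum hξ S.x S.x_y S.y_z e h hp, S.u_u, hv]

theorem freeLift_rel (hξ : IsPrimitiveRoot ξ (2 * m)) (he : e = (1 + m) * d / 2)
    ⦃a b : Free k m⦄ (h : Rel m d ξ a b) : S.freeLift a = S.freeLift b := by
  induction h with
  | x_mul_xinv => simp [freeLift_x, freeLift_xinv]
  | xinv_mul_x => simp [freeLift_x, freeLift_xinv]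
  | x_g =>
    simp only [map_mul, freeLift_x, freeLift_g]
    rw [← mul_assoc, ← pow_succ', pow_succ, mul_assoc, mul_assoc, S.x_z]
  | x_y => simp only [map_mul, freeLift_x, freeLift_y, S.x_y]
  | y_g =>
    simp only [map_mul, map_smul, freeLift_y, freeLift_g, ← g_eq]
    rw [S.y_mul_g hξ, ← Nat.cast_one, chi_natCast hξ, pow_one]
  | y_pow => simp only [map_pow, map_sub, map_one, freeLift_x, freeLift_y, S.y_pow]
  | g_pow =>
    simp only [map_pow, map_sub, map_one, freeLift_x, freeLift_g, ← g_eq]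
    rw [g_pow, ZMod.natCast_self, Z_zero, mul_one, ← Nat.cast_mul, X_natCast, mul_comm]
  | x_u i hi => simp only [map_mul, freeLift_x, freeLift_xinv, freeLift_u, S.x_u]
  | y_u i hi =>
    simp only [map_mul, map_fphi, freeLift_x, freeLift_y, freeLift_u, S.y_u]
    rw [← chi_intCast hξ, sub_mul, one_mul, smul_mul_assoc]
    push_cast
    rw [neg_add']
  | y_u' i hi =>
    simp only [map_mul, map_fphi, map_smul, map_pow, freeLift_x, freeLift_y, freeLift_u, ← S.u_y]
    rw [S.y_u, ← chi_intCast hξ, sub_mul, one_mul, smul_mul_assoc]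
    push_cast
    rw [neg_add']
  | u_g i hi =>
    simp only [map_mul, map_smul, map_pow, freeLift_xinv, freeLift_g, freeLift_u, ← g_eq,
      Int.cast_natCast]
    rw [← X_neg_one, g, u_mul_X_assoc, S.u_mul_Z hξ, mul_one, chi_natCast hξ, mul_smul_comm]
    have h1 : S.X (-1) ^ (2 * d) = S.X (-(2 * d)) := by
      rw [X, X, ← Units.val_pow_eq_pow_val, ← zpow_natCast, ← zpow_mul]
      congr 2
      push_cast; ring
    simp only [h1, mul_assoc, X_mul_X_assoc]
    congr 3
    ring
  | u_u_lt i j hi hj hij =>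
    simp only [map_mul, map_smul, map_pow, map_fphiProd, freeLift_xinv, freeLift_g, freeLift_u,
      freeLift_x, freeLift_y, Int.cast_natCast, ← he]
    exact S.u_mul_u_natCast hξ (by omega) (by push_cast; rfl)
  | u_u_eq i j hi hj hij =>
    simp only [map_mul, map_smul, map_pow, freeLift_xinv, freeLift_g, freeLift_u,
      freeLift_y, Int.cast_natCast, ← he]
    rw [S.u_mul_u_natCast hξ (p := i + j) (N := 0) (by omega) (by push_cast; rfl)]
    simp [phiProd]
  | u_u_gt i j hi hj hij =>
    simp only [map_mul, map_smul, map_pow, map_fphiProd, freeLift_xinv, freeLift_g, freeLift_u,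
      freeLift_x, freeLift_y, Int.cast_natCast, ← he, Nat.sub_zero]
    rw [phiProd_mul_phiProd hξ _ (by omega)]
    exact S.u_mul_u_natCast hξ (by omega) (by rw [Nat.cast_sub hij]; simp)

end Sys

section

attribute [local instance] algebra

/-- The quotient map as a homomorphism of algebras. -/
noncomputable def mkAlg (m d : ℕ) (ξ : k) : Free k m →ₐ[k] D m d ξ :=
  { mk m d ξ with commutes' := mk_algebraMap m d ξ }

theorem mkAlg_apply (a : Free k m) : mkAlg m d ξ a = mk m d ξ a := rfl

theorem mkAlg_surjective : Function.Surjective (mkAlg m d ξ) :=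
  RingQuot.mkRingHom_surjective _

/-- The homomorphism from `D(m,d,ξ)` defined by a system. -/
noncomputable def Sys.lift [NeZero m] {A : Type*} [Ring A] [Algebra k A] (S : Sys m d e ξ A)
    (hξ : IsPrimitiveRoot ξ (2 * m)) (he : e = (1 + m) * d / 2) : D m d ξ →ₐ[k] A :=
  RingQuot.liftAlgHom k (s := Rel m d ξ) ⟨S.freeLift, S.freeLift_rel hξ he⟩

theorem Sys.lift_mk [NeZero m] {A : Type*} [Ring A] [Algebra k A] (S : Sys m d e ξ A)
    (hξ : IsPrimitiveRoot ξ (2 * m)) (he : e = (1 + m) * d / 2) (a : Free k m) :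
    S.lift hξ he (DHopf.mk m d ξ a) = S.freeLift a := by
  have h := RingQuot.liftAlgHom_mkAlgHom_apply k S.freeLift (S.freeLift_rel hξ he) a
  rw [← AlgHom.coe_toRingHom (RingQuot.mkAlgHom k _), RingQuot.mkAlgHom_coe] at h
  exact h

theorem mk_commute_zpow {a : Free k m} (h : (x m d ξ : D m d ξ) * mk m d ξ a = mk m d ξ a * x m d ξ)
    (n : ℤ) : ((x m d ξ ^ n : (D m d ξ)ˣ) : D m d ξ) * mk m d ξ a
      = mk m d ξ a * ((x m d ξ ^ n : (D m d ξ)ˣ) : D m d ξ) :=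
  (Commute.units_zpow_right (show Commute (mk m d ξ a) (x m d ξ : D m d ξ) from h.symm) n).symm.eq

theorem mk_x_mul_g : (x m d ξ : D m d ξ) * mk m d ξ (fg k m) = mk m d ξ (fg k m) * x m d ξ := by
  rw [val_x, ← map_mul, ← map_mul, mk_rel m d ξ Rel.x_g]

theorem mk_x_mul_y : (x m d ξ : D m d ξ) * y m d ξ = y m d ξ * x m d ξ := by
  rw [val_x, y, ← map_mul, ← map_mul, mk_rel m d ξ Rel.x_y]

theorem zpow_mul_g_pow (n : ℕ) :
    (((x m d ξ ^ (-(d : ℤ)) : (D m d ξ)ˣ) : D m d ξ) * mk m d ξ (fg k m)) ^ n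
      = ((x m d ξ ^ (-(d * n : ℤ)) : (D m d ξ)ˣ) : D m d ξ) * mk m d ξ (fg k m) ^ n := by
  have h : Commute ((x m d ξ ^ (-(d : ℤ)) : (D m d ξ)ˣ) : D m d ξ) (mk m d ξ (fg k m)) :=
    mk_commute_zpow mk_x_mul_g _
  rw [h.mul_pow, ← Units.val_pow_eq_pow_val, ← zpow_natCast, ← zpow_mul, neg_mul]

theorem exists_natCast [NeZero m] (i : ZMod m) : ∃ n : ℕ, n < m ∧ (n : ZMod m) = i :=
  ⟨i.val, ZMod.val_lt i, ZMod.natCast_zmod_val i⟩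

theorem x_pow_mul_zpow_mul (t : D m d ξ) :
    (x m d ξ : D m d ξ) ^ d * (((x m d ξ ^ (-(d : ℤ)) : (D m d ξ)ˣ) : D m d ξ) * t) = t := by
  rw [← mul_assoc, ← Units.val_pow_eq_pow_val, ← zpow_natCast, ← Units.val_mul, ← zpow_add,
    add_neg_cancel, zpow_zero, Units.val_one, one_mul]

/-- The generators of `D(m,d,ξ)` form a system. -/
noncomputable def sysD [NeZero m] (hξ : IsPrimitiveRoot ξ (2 * m)) (he : e = (1 + m) * d / 2) :
    Sys m d e ξ (D m d ξ) :=
  have hyz : y m d ξ * (((x m d ξ ^ (-(d : ℤ)) : (D m d ξ)ˣ) : D m d ξ) * mk m d ξ (fg k m))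
      = ξ ^ 2 • ((((x m d ξ ^ (-(d : ℤ)) : (D m d ξ)ˣ) : D m d ξ) * mk m d ξ (fg k m))
        * y m d ξ) := by
    rw [y, ← mul_assoc, ← mk_commute_zpow mk_x_mul_y, mul_assoc, mul_assoc, ← mul_smul_comm]
    congr 1
    have h := congrArg (mkAlg m d ξ) (rfl : fy k m * fg k m = _)
    rw [← map_mul, mk_rel m d ξ Rel.y_g, ← mkAlg_apply, map_smul, map_mul]
    rfl
  have hxz : (x m d ξ : D m d ξ)
        * (((x m d ξ ^ (-(d : ℤ)) : (D m d ξ)ˣ) : D m d ξ) * mk m d ξ (fg k m))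
      = (((x m d ξ ^ (-(d : ℤ)) : (D m d ξ)ˣ) : D m d ξ) * mk m d ξ (fg k m)) * x m d ξ := by
    rw [mul_assoc, ← mk_x_mul_g, ← mul_assoc, ← mul_assoc]
    congr 1
    exact ((Commute.refl (x m d ξ : D m d ξ)).units_zpow_right _).eq
  { x := x m d ξ
    z := ((x m d ξ ^ (-(d : ℤ)) : (D m d ξ)ˣ) : D m d ξ) * mk m d ξ (fg k m)
    y := y m d ξ
    u a := mk m d ξ (FreeAlgebra.ι k (Gen.u a))
    x_z := hxz
    x_y := mk_x_mul_y
    y_z := hyz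
    z_pow := by
      rw [zpow_mul_g_pow, g_pow_eq, ← Units.val_mul, ← zpow_natCast, ← zpow_add]
      rw [show -((d : ℤ) * m) + (m * d : ℕ) = 0 by push_cast; ring, zpow_zero, Units.val_one]
    y_pow := by
      rw [y, ← map_pow, mk_rel m d ξ Rel.y_pow, map_sub, map_one, map_pow]
      rfl
    x_u i := by
      obtain ⟨i, hi, rfl⟩ := exists_natCast i
      have h := mk_rel m d ξ (Rel.x_u i hi)
      simp only [map_mul, fu, Int.cast_natCast] at h
      exact h
    y_u i := by
      obtain ⟨i, hi, rfl⟩ := exists_natCast i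
      have h := mk_rel m d ξ (Rel.y_u i hi)
      simp only [← mkAlg_apply, map_mul, map_fphi, sub_mul, one_mul, smul_mul_assoc,
        ← chi_intCast hξ] at h
      simpa [fu, ← mkAlg_apply, y, sub_eq_add_neg, add_comm] using h
    u_y i := by
      obtain ⟨i, hi, rfl⟩ := exists_natCast i
      have h := (mk_rel m d ξ (Rel.y_u i hi)).trans (mk_rel m d ξ (Rel.y_u' i hi))
      simp only [← mkAlg_apply, map_mul, map_smul, map_pow] at h
      simpa only [fu, ← mkAlg_apply, y, Int.cast_natCast, val_x] using h
    u_z i := by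
      obtain ⟨i, hi, rfl⟩ := exists_natCast i
      have h := mk_rel m d ξ (Rel.u_g i hi)
      -- The x^(-d) inside z becomes x^d on passing u_i; combined with the x^(-2d) of the presented
      -- relation it restores x^(-d), and hence z.
      have hx : SemiconjBy (mk m d ξ (fu k m i)) ((x m d ξ)⁻¹ : (D m d ξ)ˣ)
          (x m d ξ : D m d ξ) := by
        have h := mk_rel m d ξ (Rel.x_u i hi)
        rw [map_mul, map_mul] at h
        exact h.symm
      have hx2 := (hx.units_zpow_right d).eq
      simp only [← mkAlg_apply, map_mul, map_smul, map_pow] at h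
      rw [inv_zpow, ← zpow_neg] at hx2
      have hfu : FreeAlgebra.ι k (Gen.u (i : ZMod m)) = fu k m i := by
        rw [fu, Int.cast_natCast]
      rw [hfu, ← mul_assoc, hx2, mul_assoc, chi_natCast hξ]
      simp only [← mkAlg_apply]
      rw [h, mul_smul_comm, mul_assoc, mul_assoc, ← mul_assoc]
      congr 2
      change ((x m d ξ ^ (d : ℤ) : (D m d ξ)ˣ) : D m d ξ)
        * (((x m d ξ)⁻¹ : (D m d ξ)ˣ) : D m d ξ) ^ (2 * d) = _
      rw [← Units.val_pow_eq_pow_val, ← Units.val_mul, inv_pow, ← zpow_natCast, ← zpow_neg,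
        ← zpow_add]
      congr 2
      push_cast; ring
    u_u i j := by
      obtain ⟨i, hi, rfl⟩ := exists_natCast i
      obtain ⟨j, hj, rfl⟩ := exists_natCast j
      -- The three cases of the product relation enter only through the values of p and N.
      have key : ∀ {p N : ℕ}, N + p + 1 = m → (p : ZMod m) = i + j →
          mk m d ξ (FreeAlgebra.ι k (Gen.u (i : ZMod m)))
            * mk m d ξ (FreeAlgebra.ι k (Gen.u (j : ZMod m)))
          = coef m ξ j • ((((x m d ξ)⁻¹ : (D m d ξ)ˣ) : D m d ξ) ^ e
            * phiProd ξ ((x m d ξ : D m d ξ) ^ d) i N * y m d ξ ^ p * mk m d ξ (fg k m)) →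
          mk m d ξ (FreeAlgebra.ι k (Gen.u (i : ZMod m)))
            * mk m d ξ (FreeAlgebra.ι k (Gen.u (j : ZMod m)))
          = ∑ r ∈ Finset.range (m - ((i : ZMod m) + j).val),
            ((m : k)⁻¹ * quad m ξ j * qbin (ξ ^ 2) ((i : ZMod m) + j).val r
              * chi m ξ (i + j - i * r)) •
            (((x m d ξ ^ ((d : ℤ) * r + d - e) : (D m d ξ)ˣ) : D m d ξ)
              * (((x m d ξ ^ (-(d : ℤ)) : (D m d ξ)ˣ) : D m d ξ) * mk m d ξ (fg k m)
                * y m d ξ ^ ((i : ZMod m) + j).val)) := by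
        intro p N h hp hu
        have hv : ((i : ZMod m) + j).val = p := by rw [← hp, ZMod.val_cast_of_lt (by omega)]
        rw [hv, ← smul_phiProd_eq_sum hξ (x m d ξ) mk_x_mul_y hyz e h hp, hu,
          x_pow_mul_zpow_mul]
      rcases lt_trichotomy (i + j + 1) m with hij | hij | hij
      · refine key (p := i + j) (N := m - 1 - j - i) (by omega) (by push_cast; rfl) ?_
        have h := mk_rel m d ξ (Rel.u_u_lt i j hi hj (by omega))
        simp only [← mkAlg_apply, map_mul, map_smul, map_pow, map_fphiProd, fu, Int.cast_natCast,
          ← he] at h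
        exact h
      · refine key (p := i + j) (N := 0) (by omega) (by push_cast; rfl) ?_
        have h := mk_rel m d ξ (Rel.u_u_eq i j hi hj (by omega))
        simp only [phiProd, List.range'_zero, List.map_nil, List.prod_nil, mul_one]
        simp only [← mkAlg_apply, map_mul, map_smul, map_pow, fu, Int.cast_natCast,
          ← he] at h
        exact h
      · refine key (p := i + j - m) (N := m - i + (m - 1 - j)) (by omega)
          (by rw [Nat.cast_sub (by omega)]; simp) ?_
        have h := mk_rel m d ξ (Rel.u_u_gt i j hi hj (by omega))
        rw [← phiProd_mul_phiProd hξ _ (by omega)]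
        simp only [← mkAlg_apply, map_mul, map_smul, map_pow, map_fphiProd, fu, Int.cast_natCast,
          ← he, Nat.sub_zero] at h
        exact h }

end

end Lift

end DHopf

namespace DHopf

/-! ### The Hopf algebra structure -/

/-! ### Convolution with an algebra anti-homomorphism -/

section Antipode

variable {k A : Type*} [Field k] [Ring A] [Algebra k A]

open MulOpposite

/-- The linear map underlying an anti-homomorphism. -/
def antiLin (S : A →ₐ[k] Aᵐᵒᵖ) : A →ₗ[k] A :=
  (opLinearEquiv k).symm.toLinearMap ∘ₗ S.toLinearMap

theorem antiLin_apply (S : A →ₐ[k] Aᵐᵒᵖ) (a : A) : antiLin S a = unop (S a) := rfl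

theorem antiLin_mul (S : A →ₐ[k] Aᵐᵒᵖ) (a b : A) :
    antiLin S (a * b) = antiLin S b * antiLin S a := by
  rw [antiLin_apply, map_mul, unop_mul]; rfl

/-- The map `a ⊗ b ↦ S(a) b`. -/
noncomputable def convLeft (S : A →ₐ[k] Aᵐᵒᵖ) : A ⊗[k] A →ₗ[k] A :=
  LinearMap.mul' k A ∘ₗ (antiLin S).rTensor A

/-- The map `a ⊗ b ↦ a S(b)`. -/
noncomputable def convRight (S : A →ₐ[k] Aᵐᵒᵖ) : A ⊗[k] A →ₗ[k] A :=
  LinearMap.mul' k A ∘ₗ (antiLin S).lTensor A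

theorem convLeft_tmul (S : A →ₐ[k] Aᵐᵒᵖ) (a b : A) :
    convLeft S (a ⊗ₜ b) = antiLin S a * b := by simp [convLeft]

theorem convRight_tmul (S : A →ₐ[k] Aᵐᵒᵖ) (a b : A) :
    convRight S (a ⊗ₜ b) = a * antiLin S b := by simp [convRight]

/-- Anti-multiplicativity nests the contraction of t between S(a) and b; being a scalar there, it
can be pulled out. Hence the antipode axiom passes to products and need only be checked on
generators. -/
theorem convLeft_mul (S : A →ₐ[k] Aᵐᵒᵖ) (t w : A ⊗[k] A) (c : k)
    (h : convLeft S t = algebraMap k A c) : convLeft S (t * w) = c • convLeft S w := by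
  induction w with
  | zero => simp
  | add w v hw hv => rw [mul_add, map_add, map_add, hw, hv, smul_add]
  | tmul a b =>
    have h1 : convLeft S (t * (a ⊗ₜ b)) = antiLin S a * convLeft S t * b := by
      clear h
      induction t with
      | zero => simp
      | add t v ht hv => rw [add_mul, map_add, map_add, ht, hv, mul_add, add_mul]
      | tmul p q =>
        rw [Algebra.TensorProduct.tmul_mul_tmul, convLeft_tmul, convLeft_tmul, antiLin_mul]
        simp only [mul_assoc]
    rw [h1, h, convLeft_tmul, ← Algebra.commutes, mul_assoc, Algebra.smul_def]

theorem convRight_mul (S : A →ₐ[k] Aᵐᵒᵖ) (t w : A ⊗[k] A) (c : k)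
    (h : convRight S w = algebraMap k A c) : convRight S (t * w) = c • convRight S t := by
  induction t with
  | zero => simp
  | add t v ht hv => rw [add_mul, map_add, map_add, ht, hv, smul_add]
  | tmul a b =>
    have h1 : convRight S ((a ⊗ₜ b) * w) = a * convRight S w * antiLin S b := by
      clear h
      induction w with
      | zero => simp
      | add t v ht hv => rw [mul_add, map_add, map_add, ht, hv, mul_add, add_mul]
      | tmul p q =>
        rw [Algebra.TensorProduct.tmul_mul_tmul, convRight_tmul, convRight_tmul, antiLin_mul]
        simp only [mul_assoc]
    rw [h1, h, convRight_tmul, ← Algebra.commutes, mul_assoc, Algebra.smul_def]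

end Antipode

section Hopf

attribute [local instance] algebra

variable {k : Type*} [Field k] {m d e : ℕ} {ξ : k} [NeZero m]

namespace Sys

variable {A : Type*} [Ring A] [Algebra k A] (S : Sys m d e ξ A)
  (hξ : IsPrimitiveRoot ξ (2 * m)) (he : e = (1 + m) * d / 2)

theorem lift_X (n : ℤ) : S.lift hξ he ((sysD hξ he).X n) = S.X n := by
  have h : Units.map (S.lift hξ he).toMonoidHom (DHopf.x m d ξ) = S.x := by
    ext
    exact (S.lift_mk hξ he _).trans S.freeLift_x
  have h2 := congrArg (fun v : Aˣ => ((v ^ n : Aˣ) : A)) h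
  simp only [← map_zpow] at h2
  exact h2

theorem X_neg_mul_g : S.X (-d) * S.g = S.z := by
  rw [g, X_mul_X_assoc, neg_add_cancel, X_zero, one_mul, Z_one]

theorem lift_z : S.lift hξ he (sysD hξ he).z = S.z := by
  change S.lift hξ he ((sysD hξ he).X (-d) * DHopf.mk m d ξ (fg k m)) = _
  rw [map_mul, lift_X, lift_mk, freeLift_g, ← g_eq, X_neg_mul_g]

theorem lift_Z (a : ZMod m) : S.lift hξ he ((sysD hξ he).Z a) = S.Z a := by
  rw [Z, map_pow, lift_z]; rfl

theorem lift_y : S.lift hξ he (sysD hξ he).y = S.y := (S.lift_mk hξ he _).trans S.freeLift_y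

theorem lift_u (a : ZMod m) : S.lift hξ he ((sysD hξ he).u a) = S.u a :=
  (S.lift_mk hξ he _).trans (FreeAlgebra.lift_ι_apply _ _)

end Sys

variable (hξ : IsPrimitiveRoot ξ (2 * m)) (he : e = (1 + m) * d / 2)

theorem mk_g_eq : mk m d ξ (fg k m) = (sysD hξ he).g := by
  rw [Sys.g_eq]
  exact (x_pow_mul_zpow_mul _).symm

theorem D_induction {P : D m d ξ → Prop} (hc : ∀ c : k, P (algebraMap k (D m d ξ) c))
    (hadd : ∀ a b, P a → P b → P (a + b)) (hmul : ∀ a b, P a → P b → P (a * b))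
    (hX : ∀ n, P ((sysD hξ he).X n)) (hg : P (sysD hξ he).g) (hy : P (sysD hξ he).y)
    (hu : ∀ a, P ((sysD hξ he).u a)) (a : D m d ξ) : P a := by
  obtain ⟨a, rfl⟩ := mkAlg_surjective a
  induction a using FreeAlgebra.induction with
  | grade0 c => rw [AlgHom.commutes]; exact hc c
  | grade1 s =>
    cases s with
    | x => simpa only [Sys.X_one] using! hX 1
    | xinv => simpa only [Sys.X_neg_one] using! hX (-1)
    | g => rw [← mk_g_eq] at hg; exact hg
    | y => exact hy
    | u a => exact hu a
  | mul a b ha hb => rw [map_mul]; exact hmul _ _ ha hb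
  | add a b ha hb => rw [map_add]; exact hadd _ _ ha hb

theorem D_hom_ext {B : Type*} [Semiring B] [Algebra k B] {f f' : D m d ξ →ₐ[k] B}
    (hX : ∀ n, f ((sysD hξ he).X n) = f' ((sysD hξ he).X n))
    (hg : f (sysD hξ he).g = f' (sysD hξ he).g) (hy : f (sysD hξ he).y = f' (sysD hξ he).y)
    (hu : ∀ a, f ((sysD hξ he).u a) = f' ((sysD hξ he).u a)) : f = f' := by
  refine AlgHom.ext fun a => ?_
  induction a using D_induction hξ he with
  | hc c => rw [AlgHom.commutes, AlgHom.commutes]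
  | hadd a b ha hb => rw [map_add, map_add, ha, hb]
  | hmul a b ha hb => rw [map_mul, map_mul, ha, hb]
  | hX n => exact hX n
  | hg => exact hg
  | hy => exact hy
  | hu a => exact hu a

theorem g_mul_inv : (sysD hξ he).g * ((sysD hξ he).X (-d) * (sysD hξ he).Z (-1)) = 1 := by
  rw [Sys.g, mul_assoc, Sys.Z_mul_X_assoc, Sys.X_mul_X_assoc, Sys.Z_mul_Z, add_neg_cancel,
    add_neg_cancel, Sys.X_zero, Sys.Z_zero, one_mul]

theorem inv_mul_g : ((sysD hξ he).X (-d) * (sysD hξ he).Z (-1)) * (sysD hξ he).g = 1 := by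
  rw [Sys.g, mul_assoc, Sys.Z_mul_X_assoc, Sys.X_mul_X_assoc, Sys.Z_mul_Z, neg_add_cancel,
    neg_add_cancel, Sys.X_zero, Sys.Z_zero, one_mul]

theorem val_x_zpow_mul_g_pow (n : ℤ) (j : ℕ) :
    ((x m d ξ ^ n * g m d ξ ^ j : (D m d ξ)ˣ) : D m d ξ)
      = (sysD hξ he).X (n + d * j) * (sysD hξ he).Z j := by
  rw [Units.val_mul, Units.val_pow_eq_pow_val, val_g, mk_g_eq hξ he, Sys.g_pow,
    ← Sys.X_mul_X_assoc]
  rfl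

theorem val_g_inv : (((g m d ξ)⁻¹ : (D m d ξ)ˣ) : D m d ξ)
    = (sysD hξ he).X (-d) * (sysD hξ he).Z (-1) := by
  refine Units.inv_eq_of_mul_eq_one_right ?_
  rw [val_g, mk_g_eq hξ he, g_mul_inv]

theorem u_eq (s : ℤ) : u m d ξ s = (sysD hξ he).u s := rfl

/-- With (1-m)d/2 = d - e and g = x^d z, the total exponent id + 3(d-e) + d(m-i-1) of x reduces to d
- e, and z^(m-i-1) = z^(-1-i). -/
theorem ua_natCast_eq (he2 : 2 * e = (1 + m) * d) {i : ℕ} (hi : i < m) : (sysD hξ he).ua (i : ZMod m)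
    = ((-1 : k) ^ i * ξ ^ (-(i : ℤ)) * (ξ ^ 2) ^ (-((i : ℤ) * ((i : ℤ) + 1) / 2))) •
        (((x m d ξ ^ ((i : ℤ) * (d : ℤ) + 3 * ((1 - (m : ℤ)) * (d : ℤ) / 2))
          * g m d ξ ^ (m - i - 1) : (D m d ξ)ˣ) : D m d ξ) * u m d ξ i) := by
  have h1 : (1 - (m : ℤ)) * (d : ℤ) / 2 = d - e := by
    refine Int.ediv_eq_of_eq_mul_right two_ne_zero ?_
    zify at he2
    linear_combination he2
  have h2 : ((m - i - 1 : ℕ) : ℤ) = m - i - 1 := by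
    rw [Nat.sub_sub, Nat.cast_sub (by omega)]; push_cast; ring
  have h3 : ((m - i - 1 : ℕ) : ZMod m) = -1 - i := by
    have := congrArg (Int.cast (R := ZMod m)) h2
    push_cast at this
    rw [this, ZMod.natCast_self]; ring
  rw [Sys.ua, sphase_natCast hξ, val_x_zpow_mul_g_pow hξ he, h3, h2, h1, u_eq hξ he,
    mul_assoc (Sys.X _ _),
    Int.cast_natCast,
    show (i : ℤ) * d + 3 * (d - e) + d * (m - i - 1) = d - e by
      zify at he2
      linear_combination -he2]

variable (he2 : 2 * e = (1 + m) * d)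

/-- The antipode as a homomorphism to the opposite algebra. -/
noncomputable def antiD : D m d ξ →ₐ[k] (D m d ξ)ᵐᵒᵖ := ((sysD hξ he).opposite hξ he2).lift hξ he

theorem antiD_X (n : ℤ) :
    antiLin (antiD hξ he he2) ((sysD hξ he).X n) = (sysD hξ he).X (-n) := by
  rw [antiLin_apply, antiD, Sys.lift_X, Sys.X]
  exact congrArg MulOpposite.unop ((sysD hξ he).val_opUnit_zpow n)

theorem antiD_z :
    antiLin (antiD hξ he he2) (sysD hξ he).z = (sysD hξ he).Z (-1) := by
  rw [antiLin_apply, antiD, Sys.lift_z]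
  rfl

theorem antiD_Z (a : ZMod m) :
    antiLin (antiD hξ he he2) ((sysD hξ he).Z a) = (sysD hξ he).Z (-a) := by
  obtain ⟨n, rfl⟩ := ZMod.natCast_zmod_surjective a
  rw [Sys.Z_natCast]
  induction n with
  | zero => simp [antiLin_apply, Sys.Z_zero]
  | succ n ih =>
    rw [pow_succ, antiLin_mul, ih, antiD_z, Sys.Z_mul_Z]
    congr 1
    push_cast; ring

theorem antiD_g :
    antiLin (antiD hξ he he2) (sysD hξ he).g = (sysD hξ he).X (-d) * (sysD hξ he).Z (-1) := by
  rw [Sys.g, antiLin_mul, antiD_X, antiD_Z, Sys.Z_mul_X]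

theorem antiD_y : antiLin (antiD hξ he he2) (sysD hξ he).y = (sysD hξ he).ya := by
  rw [antiLin_apply, antiD, Sys.lift_y]; rfl

theorem antiD_u (i : ZMod m) :
    antiLin (antiD hξ he he2) ((sysD hξ he).u i) = (sysD hξ he).ua i := by
  rw [antiLin_apply, antiD, Sys.lift_u]; rfl

variable [CharZero k]

/-- The coproduct. -/
noncomputable def Delta : D m d ξ →ₐ[k] D m d ξ ⊗[k] D m d ξ :=
  ((sysD hξ he).tensor hξ).lift hξ he

/-- The counit. -/
noncomputable def Eps : D m d ξ →ₐ[k] k := (sysCounit d e hξ).lift hξ he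

theorem Delta_X (n : ℤ) :
    Delta hξ he ((sysD hξ he).X n) = (sysD hξ he).X n ⊗ₜ (sysD hξ he).X n := by
  rw [Delta, Sys.lift_X, Sys.X]
  exact Sys.val_xx_zpow _ n

theorem Delta_Z (a : ZMod m) :
    Delta hξ he ((sysD hξ he).Z a) = (sysD hξ he).Z a ⊗ₜ (sysD hξ he).Z a := by
  rw [Delta, Sys.lift_Z]
  refine ((sysD hξ he).Z_tmul_Z_pow a.val).trans ?_
  rw [ZMod.natCast_zmod_val]

theorem Delta_g : Delta hξ he (sysD hξ he).g = (sysD hξ he).g ⊗ₜ (sysD hξ he).g := by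
  rw [Sys.g, map_mul, Delta_X, Delta_Z, Algebra.TensorProduct.tmul_mul_tmul]

theorem Delta_y : Delta hξ he (sysD hξ he).y
    = (sysD hξ he).y ⊗ₜ (sysD hξ he).g + 1 ⊗ₜ (sysD hξ he).y :=
  Sys.lift_y _ hξ he

theorem Delta_u (i : ZMod m) : Delta hξ he ((sysD hξ he).u i)
    = ∑ a : ZMod m, chi m ξ (a * (i - a)) •
        ((sysD hξ he).u a ⊗ₜ ((sysD hξ he).Z a * (sysD hξ he).u (i - a))) :=
  Sys.lift_u _ hξ he i

theorem Eps_X (n : ℤ) : Eps hξ he ((sysD hξ he).X n) = 1 := by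
  rw [Eps, Sys.lift_X, Sys.X]
  change (((1 : kˣ) ^ n : kˣ) : k) = 1
  simp

theorem Eps_Z (a : ZMod m) : Eps hξ he ((sysD hξ he).Z a) = 1 := by
  rw [Eps, Sys.lift_Z]
  exact one_pow _

theorem Eps_g : Eps hξ he (sysD hξ he).g = 1 := by
  rw [Sys.g, map_mul, Eps_X, Eps_Z, one_mul]

theorem Eps_y : Eps hξ he (sysD hξ he).y = 0 := Sys.lift_y _ hξ he

theorem Eps_u (i : ZMod m) : Eps hξ he ((sysD hξ he).u i) = if i = 0 then 1 else 0 :=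
  Sys.lift_u _ hξ he i

theorem Delta_coassoc :
    (Algebra.TensorProduct.assoc k k k (D m d ξ) (D m d ξ) (D m d ξ)).toAlgHom.comp
      ((Algebra.TensorProduct.map (Delta hξ he) (.id k (D m d ξ))).comp (Delta hξ he))
      = (Algebra.TensorProduct.map (.id k (D m d ξ)) (Delta hξ he)).comp (Delta hξ he) := by
  refine D_hom_ext hξ he (fun n => ?_) ?_ ?_ (fun i => ?_)
  · simp [Delta_X]
  · simp [Delta_g]
  · simp [Delta_y, Delta_g, TensorProduct.tmul_add, TensorProduct.add_tmul, add_assoc,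
      Algebra.TensorProduct.one_def]
  · simp only [AlgHom.comp_apply, Delta_u, map_sum, map_smul, Algebra.TensorProduct.map_tmul,
      AlgHom.id_apply, map_mul, Delta_Z, TensorProduct.sum_tmul, TensorProduct.tmul_sum,
      Finset.smul_sum, Finset.mul_sum, mul_smul_comm, TensorProduct.tmul_smul,
      ← TensorProduct.smul_tmul', smul_smul, Algebra.TensorProduct.tmul_mul_tmul]
    -- Both sides are sums of u_b ⊗ z^b u_(a-b) ⊗ z^a u_(i-a) after replacing the second index by a
    -- - b; the phases agree by a polynomial identity in a, b, i.
    rw [Finset.sum_comm]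
    refine Finset.sum_congr rfl fun b _ => ?_
    refine Fintype.sum_equiv (Equiv.subRight b) _ _ fun a => ?_
    rw [Equiv.subRight_apply, Sys.Z_mul_Z_assoc, add_sub_cancel, ← chi_add hξ, ← chi_add hξ,
      sub_sub_sub_cancel_right,
      show a * (i - a) + b * (a - b) = b * (i - b) + (a - b) * (i - a) by ring]
    rfl

theorem Delta_rTensor :
    (Algebra.TensorProduct.map (Eps hξ he) (.id k (D m d ξ))).comp (Delta hξ he)
      = (Algebra.TensorProduct.lid k (D m d ξ)).symm := by
  refine D_hom_ext hξ he (fun n => ?_) ?_ ?_ (fun i => ?_)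
  · simp [Delta_X, Eps_X]
  · simp [Delta_g, Eps_g]
  · simp [Delta_y, Eps_y]
  · simp [Delta_u, Eps_u, TensorProduct.ite_tmul, chi_zero, Sys.Z_zero]

theorem Delta_lTensor :
    (Algebra.TensorProduct.map (.id k (D m d ξ)) (Eps hξ he)).comp (Delta hξ he)
      = (Algebra.TensorProduct.rid k k (D m d ξ)).symm := by
  refine D_hom_ext hξ he (fun n => ?_) ?_ ?_ (fun i => ?_)
  · simp [Delta_X, Eps_X]
  · simp [Delta_g, Eps_g]
  · simp [Delta_y, Eps_y, Eps_g]
  · simp [Delta_u, Eps_u, Eps_Z, TensorProduct.tmul_ite, chi_zero, sub_eq_zero]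

/-- The bialgebra structure. -/
@[reducible] noncomputable def bialgebraD : Bialgebra k (D m d ξ) :=
  Bialgebra.ofAlgHom (Delta hξ he) (Eps hξ he) (Delta_coassoc hξ he) (Delta_rTensor hξ he)
    (Delta_lTensor hξ he)

theorem convLeft_Delta (a : D m d ξ) :
    convLeft (antiD hξ he he2) (Delta hξ he a) = algebraMap k (D m d ξ) (Eps hξ he a) := by
  induction a using D_induction hξ he with
  | hc c =>
    rw [AlgHom.commutes, AlgHom.commutes, Algebra.algebraMap_eq_smul_one, map_smul,
      Algebra.TensorProduct.one_def, convLeft_tmul, antiLin_apply, map_one]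
    simp [Algebra.algebraMap_eq_smul_one]
  | hadd a b ha hb => simp only [map_add, ha, hb]
  | hmul a b ha hb =>
    rw [map_mul, convLeft_mul _ _ _ _ ha, hb, map_mul, map_mul, Algebra.smul_def]
  | hX n =>
    rw [Delta_X, convLeft_tmul, antiD_X, Eps_X, Sys.X_mul_X, neg_add_cancel, Sys.X_zero, map_one]
  | hg => rw [Delta_g, convLeft_tmul, antiD_g, Eps_g, inv_mul_g, map_one]
  | hy =>
    rw [Delta_y, map_add, convLeft_tmul, convLeft_tmul, antiD_y, Eps_y, antiLin_apply, map_one,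
      Sys.ya, neg_mul, mul_assoc, inv_mul_g]
    simp
  | hu i =>
    rw [Delta_u, map_sum, Eps_u]
    simp only [map_smul, convLeft_tmul, antiD_u]
    rw [Sys.sum_ua_mul_u _ hξ he2]
    split_ifs <;> simp

theorem convRight_Delta (a : D m d ξ) :
    convRight (antiD hξ he he2) (Delta hξ he a) = algebraMap k (D m d ξ) (Eps hξ he a) := by
  induction a using D_induction hξ he with
  | hc c =>
    rw [AlgHom.commutes, AlgHom.commutes, Algebra.algebraMap_eq_smul_one, map_smul,
      Algebra.TensorProduct.one_def, convRight_tmul, antiLin_apply, map_one]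
    simp [Algebra.algebraMap_eq_smul_one]
  | hadd a b ha hb => simp only [map_add, ha, hb]
  | hmul a b ha hb =>
    rw [map_mul, convRight_mul _ _ _ _ hb, ha, map_mul, map_mul, Algebra.smul_def,
      Algebra.commutes]
  | hX n =>
    rw [Delta_X, convRight_tmul, antiD_X, Eps_X, Sys.X_mul_X, add_neg_cancel, Sys.X_zero, map_one]
  | hg => rw [Delta_g, convRight_tmul, antiD_g, Eps_g, g_mul_inv, map_one]
  | hy =>
    rw [Delta_y, map_add, convRight_tmul, convRight_tmul, antiD_y, antiD_g, Eps_y, Sys.ya]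
    simp
  | hu i =>
    rw [Delta_u, map_sum, Eps_u]
    simp only [map_smul, convRight_tmul, antiLin_mul, antiD_u, antiD_Z]
    rw [Sys.sum_u_mul_ua _ hξ]
    split_ifs <;> simp

/-- The Hopf algebra structure. -/
@[reducible] noncomputable def hopfD : HopfAlgebra k (D m d ξ) :=
  { bialgebraD hξ he with
    antipode := antiLin (antiD hξ he he2)
    mul_antipode_rTensor_comul := LinearMap.ext (convLeft_Delta hξ he he2)
    mul_antipode_lTensor_comul := LinearMap.ext (convRight_Delta hξ he he2) }

/-- The factor x^(-jd) g^j is just z^j. -/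
theorem Delta_u_natCast (i : ℕ) : Delta hξ he (u m d ξ i)
    = ∑ j ∈ Finset.range m, (ξ ^ 2) ^ ((j : ℤ) * ((i : ℤ) - (j : ℤ))) •
        (u m d ξ j ⊗ₜ[k]
          (((x m d ξ ^ (-((j : ℤ) * (d : ℤ))) * g m d ξ ^ j : (D m d ξ)ˣ) : D m d ξ)
            * u m d ξ ((i : ℤ) - (j : ℤ)))) := by
  rw [u_eq hξ he, Delta_u, sum_zmod_eq_sum_range]
  refine Finset.sum_congr rfl fun j _ => ?_
  rw [u_eq hξ he, u_eq hξ he, val_x_zpow_mul_g_pow hξ he, ← chi_intCast hξ,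
    show -((j : ℤ) * (d : ℤ)) + d * j = 0 by ring, Sys.X_zero, one_mul]
  push_cast
  rfl

end Hopf

end DHopf

theorem proposition4p2 {k : Type*} [Field k] [IsAlgClosed k] [CharZero k]
    (m d : ℕ) [NeZero m] (hmd : Even ((1 + m) * d))
    (ξ : k) (hξ : IsPrimitiveRoot ξ (2 * m)) :
    ∃ H : HopfAlgebra k (DHopf.D m d ξ),
      -- the underlying algebra is the given one
      H.toAlgebra = DHopf.algebra m d ξ ∧
      -- the coproduct
      Coalgebra.comul (R := k) (DHopf.x m d ξ : DHopf.D m d ξ)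
        = (DHopf.x m d ξ : DHopf.D m d ξ) ⊗ₜ[k] (DHopf.x m d ξ : DHopf.D m d ξ) ∧
      Coalgebra.comul (R := k) (DHopf.g m d ξ : DHopf.D m d ξ)
        = (DHopf.g m d ξ : DHopf.D m d ξ) ⊗ₜ[k] (DHopf.g m d ξ : DHopf.D m d ξ) ∧
      Coalgebra.comul (R := k) (DHopf.y m d ξ)
        = DHopf.y m d ξ ⊗ₜ[k] (DHopf.g m d ξ : DHopf.D m d ξ)
          + (1 : DHopf.D m d ξ) ⊗ₜ[k] DHopf.y m d ξ ∧
      (∀ i : ℕ, i < m →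
        Coalgebra.comul (R := k) (DHopf.u m d ξ i)
          = ∑ j ∈ Finset.range m, (ξ ^ 2) ^ ((j : ℤ) * ((i : ℤ) - (j : ℤ))) •
              (DHopf.u m d ξ j ⊗ₜ[k]
                (((DHopf.x m d ξ ^ (-((j : ℤ) * (d : ℤ))) * DHopf.g m d ξ ^ j :
                    (DHopf.D m d ξ)ˣ) : DHopf.D m d ξ)
                  * DHopf.u m d ξ ((i : ℤ) - (j : ℤ))))) ∧
      -- the counit
      Coalgebra.counit (R := k) (DHopf.x m d ξ : DHopf.D m d ξ) = 1 ∧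
      Coalgebra.counit (R := k) (DHopf.g m d ξ : DHopf.D m d ξ) = 1 ∧
      Coalgebra.counit (R := k) (DHopf.y m d ξ) = 0 ∧
      Coalgebra.counit (R := k) (DHopf.u m d ξ 0) = 1 ∧
      (∀ s : ℕ, 1 ≤ s → s < m → Coalgebra.counit (R := k) (DHopf.u m d ξ s) = 0) ∧
      -- the antipode, which is an algebra anti-homomorphism
      HopfAlgebra.antipode k (1 : DHopf.D m d ξ) = 1 ∧
      (∀ a b : DHopf.D m d ξ, HopfAlgebra.antipode k (a * b)
        = HopfAlgebra.antipode k b * HopfAlgebra.antipode k a) ∧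
      HopfAlgebra.antipode k (DHopf.x m d ξ : DHopf.D m d ξ)
        = ((DHopf.x m d ξ)⁻¹ : (DHopf.D m d ξ)ˣ) ∧
      HopfAlgebra.antipode k (DHopf.g m d ξ : DHopf.D m d ξ)
        = ((DHopf.g m d ξ)⁻¹ : (DHopf.D m d ξ)ˣ) ∧
      HopfAlgebra.antipode k (DHopf.y m d ξ)
        = -(DHopf.y m d ξ * ((DHopf.g m d ξ)⁻¹ : (DHopf.D m d ξ)ˣ)) ∧
      (∀ i : ℕ, i < m →
        HopfAlgebra.antipode k (DHopf.u m d ξ i)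
          = ((-1 : k) ^ i * ξ ^ (-(i : ℤ)) * (ξ ^ 2) ^ (-((i : ℤ) * ((i : ℤ) + 1) / 2))) •
              (((DHopf.x m d ξ ^ ((i : ℤ) * (d : ℤ) + 3 * ((1 - (m : ℤ)) * (d : ℤ) / 2))
                  * DHopf.g m d ξ ^ (m - i - 1) : (DHopf.D m d ξ)ˣ) : DHopf.D m d ξ)
                * DHopf.u m d ξ i)) := by
  let := DHopf.algebra m d ξ
  have he2 : 2 * ((1 + m) * d / 2) = (1 + m) * d := Nat.mul_div_cancel' hmd.two_dvd
  -- The Hopf structure is built on top of the quotient algebra structure, so the two algebra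
  -- structures agree definitionally; e is taken to be (1+m)d/2, exact by parity.
  refine ⟨DHopf.hopfD hξ rfl he2, rfl, ?_, ?_, ?_, ?_, ?_, ?_, ?_, ?_, ?_, ?_, ?_, ?_, ?_, ?_, ?_⟩
  · have h := DHopf.Delta_X hξ (d := d) rfl 1
    rw [DHopf.Sys.X_one] at h
    exact h
  · have h := DHopf.Delta_g hξ (d := d) rfl
    rw [← DHopf.mk_g_eq] at h
    exact h
  · have h := DHopf.Delta_y hξ (d := d) rfl
    rw [← DHopf.mk_g_eq] at h
    exact h
  · intro i _
    exact DHopf.Delta_u_natCast hξ rfl i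
  · have h := DHopf.Eps_X hξ (d := d) rfl 1
    rw [DHopf.Sys.X_one] at h
    exact h
  · have h := DHopf.Eps_g hξ (d := d) rfl
    rw [← DHopf.mk_g_eq] at h
    exact h
  · exact DHopf.Eps_y hξ rfl
  · refine (DHopf.Eps_u hξ rfl ((0 : ℤ) : ZMod m)).trans ?_
    rw [Int.cast_zero, if_pos rfl]
  · intro s hs hsm
    refine (DHopf.Eps_u hξ rfl ((s : ℤ) : ZMod m)).trans (if_neg fun h => ?_)
    rw [Int.cast_natCast, ZMod.natCast_eq_zero_iff] at h
    have := Nat.le_of_dvd hs h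
    omega
  · exact congrArg MulOpposite.unop (map_one (DHopf.antiD hξ rfl he2))
  · exact DHopf.antiLin_mul (DHopf.antiD hξ rfl he2)
  · have h := DHopf.antiD_X hξ rfl he2 1
    rw [DHopf.Sys.X_one, DHopf.Sys.X_neg_one] at h
    exact h
  · have h := DHopf.antiD_g hξ rfl he2
    rw [← DHopf.mk_g_eq, ← DHopf.val_g_inv] at h
    exact h
  · have h := DHopf.antiD_y hξ rfl he2
    rw [DHopf.Sys.ya, ← DHopf.val_g_inv] at h
    exact h
  · intro i hi
    have h := DHopf.antiD_u hξ rfl he2 (i : ZMod m)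
    rw [DHopf.ua_natCast_eq hξ rfl he2 hi] at h
    simpa [DHopf.u_eq hξ (d := d) rfl] using! h
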